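/- **Setting.** For $x\in\mathbb Z$ let $\mathcal H_x$ be a Hilbert space of finite dimension $d_x\ge 1$. For finite $X\subset\mathbb Z$ let $\mathcal A_X=\mathcal B(\bigotimes_{x\in X}\mathcal H_x)$, let $\mathcal A^{\rm loc}=\bigcup_X\mathcal A_X$, let $\mathcal A_{\mathbb Z}$ be its norm completion, and for arbitrary $Y\subseteq\mathbb Z$ let $\mathcal A_Y\subseteq\mathcal A_{\mathbb Z}$ be the norm closure of $\bigcup_{X\subseteq Y\text{ finite}}\mathcal A_X$. $\mathcal A_Y^1$ denotes the closed unit ball of $\mathcal A_Y$, and $d(X,Y)=\min\{|x-y|:x\in X,\,y\in Y\}$ for nonempty $X,Y\subseteq\mathbb Z$. On a probability space $(\Omega,\mathcal F,\mathbb P)$ let $\Phi$ be a random interaction: to every finite $X\subset\mathbb Z$ it assigns a weakly measurable random self-adjoint $\Phi(X)\in\mathcal A_X$. Assume that $\Phi$ has finite range $R\in\{0,1,2,\dots\}$ (almost surely $\Phi(X)=0$ unless $\operatorname{diam}X\le R$) and is uniformly bounded (there is a constant $J$ such that almost surely $\|\Phi(X)\|\le J$ for all $X$). Put $H_\Lambda=\sum_{X\subseteq\Lambda}\Phi(X)$,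 $\tau^{H_\Lambda}_t(A)=e^{itH_\Lambda}Ae^{-itH_\Lambda}$, and $$h_x=\sum_{X:\ \min X=x,\ X\subseteq[x,x+R]}\Phi(X)\in\mathcal A_{[x,x+R]},\qquad x\in\mathbb Z .$$ Let $F:\{0,1,2,\dots\}\to(0,\infty)$ be non-increasing with $\lim_{n\to\infty}F(n)=0$. Assume dynamical localization with decay function $F$, uniformly in time ($\beta=0$): there is $\chi:\mathbb N\to(0,\infty)$ such that for every finite interval $\Lambda\subset\mathbb Z$ and all nonempty $X,Y\subseteq\Lambda$ with $Y\cap[\min X,\max X]=\emptyset$, $$\mathbb E\Big[\sup_{t\in\mathbb R}\ \sup_{A\in\mathcal A_X^1,\,B\in\mathcal A_Y^1}\frac{\|[\tau_t^{H_\Lambda}(A),B]\|}{\chi(|X|)(1+|t|^\beta)}\Big]\le F(d(X,Y)),\qquad \beta=0 .$$ Assume moreover that $\sum_{n\ge1}nF(n)<\infty$. **Theorem.** Almost surely the thermodynamic limit $\tau_t(A)=\lim_{n\to\infty}\tau_t^{H_{[-n,n]}}(A)$ exists for all $t\in\mathbb R$ and $A\in\mathcal A_{\mathbb Z}$ and is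 a strongly continuous one-parameter group of $*$-automorphisms of $\mathcal A_{\mathbb Z}$; its generator $\delta$ (with $\tau_t=e^{it\delta}$) contains $\mathcal A^{\rm loc}$ in its domain, and $\delta(A)=\lim_n[H_{[-n,n]},A]$ for $A\in\mathcal A^{\rm loc}$. There are a random strictly increasing sequence $(T_n)$ in $\{0,1,2,\dots\}$ and random elements $\tilde h_x\in\mathcal A_{\mathbb Z}$, $x\in\mathbb Z$, such that almost surely, for all $x$, $$\tilde h_x=\lim_{n\to\infty}\frac1{T_n}\int_0^{T_n}\tau_t(h_x)\,dt\quad\text{in norm},$$ and the following hold. 1. $(\tilde h_x)$ is a family of LIOMs of the second kind. That is: * almost surely all $\tilde h_x$ are self-adjoint and $\sup_x\|\tilde h_x\|\le K$ for a constant $K$; * there is a non-increasing $G:\{0,1,2,\dots\}\to(0,\infty)$ with $\lim_{n\to\infty}G(n)=0$ such that $\mathbb E\sup_{B\in\mathcal A_Y^1}\|[\tilde h_x,B]\|\le G(d(\{x\},Y))$ for all $x\in\mathbb Z$ and all nonempty $Y\subseteq\mathbb Z$; * almost surely $\delta(\tilde h_x)=0$ for all $x$; * almost surely $\delta(A)=\lim_{n\to\infty}\sum_{x=-n}^n[\tilde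 h_x,A]$ for all $A\in\mathcal A^{\rm loc}$, and $\sum_{x=-n}^n\tilde h_x$ generates the same dynamics in the thermodynamic limit: with $\tilde H_n=\sum_{x=-n}^n\tilde h_x$, $\lim_{n\to\infty}e^{it\tilde H_n}Ae^{-it\tilde H_n}=\tau_t(A)$ for all $t\in\mathbb R$ and $A\in\mathcal A_{\mathbb Z}$. 2. Almost surely $\tau_t(\tilde h_x)=\tilde h_x$ for all $t\in\mathbb R$ and $x\in\mathbb Z$. 3. There is a constant $C>0$ such that for all $x\in\mathbb Z$ and all nonempty $Y\subseteq\mathbb Z$ $$\mathbb E\Big(\sup_{B\in\mathcal A_Y^1}\|[\tilde h_x,B]\|\Big)\le C\,F\big(d([x,x+R],Y)\big).$$ If moreover $F(n)\le K'F(n+1)$ for some constant $K'$ and all $n$, then also, for some constant $C>0$ and all such $x$ and $Y$, the left-hand side is at most $C\,F(d(\{x\},Y))$. -/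

import Mathlib

open MeasureTheory Filter Topology
open scoped InnerProductSpace ENNReal

noncomputable section

namespace SpinChain

/-! ### The quantum spin chain

The site `x : ℤ` carries the Hilbert space `ℂ ^ d x`. The algebra of quasi-local observables is
realised faithfully and isometrically on the Hilbert space `ℓ²` of all basis configurations
`σ : ∀ x, Fin (d x)` of the infinite chain; the observables in a finite set `X` are the operators
`M ⊗ 1` which act as a matrix `M` on the coordinates in `X` and as the identity elsewhere. -/

/-- Basis configurations of the infinite chain. -/
abbrev Conf (d : ℤ → ℕ) : Type := ∀ x : ℤ, Fin (d x)

/-- Basis configurations of the finite subsystem `X`; they index a basis of `⨂ x ∈ X, ℂ ^ d x`. -/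
abbrev LocConf (d : ℤ → ℕ) (X : Finset ℤ) : Type := ∀ x : X, Fin (d x)

/-- The Hilbert space on which all observables act. -/
abbrev Hil (d : ℤ → ℕ) : Type := lp (fun _ : Conf d => ℂ) 2

/-- Bounded operators on `Hil d`. -/
abbrev Op (d : ℤ → ℕ) : Type := Hil d →L[ℂ] Hil d

variable {d : ℤ → ℕ}

open Classical in
/-- The basis vector of a configuration. -/
def ket (σ : Conf d) : Hil d := lp.single 2 σ (1 : ℂ)

/-- The part in `X` of a configuration. -/
def restr (X : Finset ℤ) (σ : Conf d) : LocConf d X := fun x => σ x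

/-- Replace the part in `X` of a configuration by `j`. -/
def patch (X : Finset ℤ) (σ : Conf d) (j : LocConf d X) : Conf d :=
  fun y => if h : y ∈ X then j ⟨y, h⟩ else σ y

/-- `T` is the operator `M ⊗ 1`, with the matrix `M` acting on the subsystem `X`. -/
def ActsAs (X : Finset ℤ) (M : Matrix (LocConf d X) (LocConf d X) ℂ) (T : Op d) : Prop :=
  ∀ τ : Conf d, T (ket τ) = ∑ j : LocConf d X, M j (restr X τ) • ket (patch X τ j)

theorem restr_patch (X : Finset ℤ) (σ : Conf d) (j : LocConf d X) :
    restr X (patch X σ j) = j := by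
  funext x; simp [restr, patch]

theorem patch_patch (X : Finset ℤ) (σ : Conf d) (i j : LocConf d X) :
    patch X (patch X σ i) j = patch X σ j := by
  funext y; by_cases h : y ∈ X <;> simp [patch, h]

theorem patch_restr (X : Finset ℤ) (σ : Conf d) : patch X σ (restr X σ) = σ := by
  funext y; by_cases h : y ∈ X <;> simp [restr, patch]

theorem inner_ket_left (σ : Conf d) (v : Hil d) : ⟪ket σ, v⟫_ℂ = v σ := by
  classical
  rw [ket, lp.inner_single_left]; simp

theorem inner_ket_ket (σ τ : Conf d) [Decidable (σ = τ)] :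
    ⟪ket σ, ket τ⟫_ℂ = if σ = τ then 1 else 0 := by
  classical
  rw [inner_ket_left, ket, lp.single_apply, Pi.single_apply]
  by_cases h : σ = τ <;> simp [h]

theorem hil_ext {v w : Hil d} (h : ∀ σ, ⟪ket σ, v⟫_ℂ = ⟪ket σ, w⟫_ℂ) : v = w := by
  apply lp.ext; funext σ
  simpa only [inner_ket_left] using h σ

theorem ActsAs.mul {X : Finset ℤ} {M N : Matrix (LocConf d X) (LocConf d X) ℂ} {S T : Op d}
    (hS : ActsAs X M S) (hT : ActsAs X N T) : ActsAs X (M * N) (S * T) := by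
  intro τ
  rw [mul_apply_eq_comp, hT τ, map_sum]
  simp only [map_smul, hS _, restr_patch, patch_patch, Matrix.mul_apply, Finset.sum_smul,
    Finset.smul_sum, smul_smul]
  rw [Finset.sum_comm]
  exact Finset.sum_congr rfl fun _ _ => Finset.sum_congr rfl fun _ _ => by rw [mul_comm]

theorem ActsAs.add {X : Finset ℤ} {M N : Matrix (LocConf d X) (LocConf d X) ℂ} {S T : Op d}
    (hS : ActsAs X M S) (hT : ActsAs X N T) : ActsAs X (M + N) (S + T) := by
  intro τ
  simp only [add_apply, hS τ, hT τ, Matrix.add_apply, add_smul,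
    Finset.sum_add_distrib]

theorem ActsAs.smul {X : Finset ℤ} {M : Matrix (LocConf d X) (LocConf d X) ℂ} {S : Op d}
    (c : ℂ) (hS : ActsAs X M S) : ActsAs X (c • M) (c • S) := by
  intro τ
  simp only [smul_apply, hS τ, Matrix.smul_apply, Finset.smul_sum, smul_smul,
    smul_eq_mul]

theorem actsAs_one (X : Finset ℤ) : ActsAs X (1 : Matrix (LocConf d X) (LocConf d X) ℂ) 1 := by
  intro τ
  simp [Matrix.one_apply, ite_smul, patch_restr]

theorem ActsAs.star {X : Finset ℤ} {M : Matrix (LocConf d X) (LocConf d X) ℂ} {S : Op d}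
    (hS : ActsAs X M S) : ActsAs X M.conjTranspose (star S) := by
  classical
  intro τ
  refine hil_ext fun σ => ?_
  rw [ContinuousLinearMap.star_eq_adjoint, ContinuousLinearMap.adjoint_inner_right, hS σ,
    sum_inner, inner_sum]
  simp only [inner_smul_left, inner_smul_right, inner_ket_ket, Matrix.conjTranspose_apply,
    mul_ite, mul_one, mul_zero]
  have key : ∀ i j : LocConf d X, patch X σ i = τ → σ = patch X τ j →
      i = restr X τ ∧ j = restr X σ := by
    rintro i j rfl h
    rw [restr_patch]
    refine ⟨rfl, ?_⟩
    conv_rhs => rw [h]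
    rw [restr_patch]
  by_cases h : patch X σ (restr X τ) = τ
  · have h' : σ = patch X τ (restr X σ) := by
      rw [← h, patch_patch, patch_restr]
    rw [Finset.sum_eq_single (restr X τ), Finset.sum_eq_single (restr X σ), if_pos h, if_pos h']
    · rfl
    · intro j _ hj
      exact if_neg fun e => hj (key _ _ h e).2
    · simp
    · intro i _ hi
      exact if_neg fun e => hi (key _ _ e h').1
    · simp
  · have h1 : ∀ i, patch X σ i ≠ τ := by
      rintro i rfl
      rw [restr_patch] at h; exact h rfl
    have h2 : ∀ j, σ ≠ patch X τ j := by
      intro j e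
      apply h
      rw [e, patch_patch, patch_restr]
    simp [h1, h2]

/-- The isometry `e_i ↦ e_{f i}` given by an injection `f` of index sets. -/
theorem exists_isometry {ι : Type} (f : ι → Conf d) (hf : Function.Injective f) :
    ∃ V : lp (fun _ : ι => ℂ) 2 →L[ℂ] Hil d, ∀ (i : ι) [DecidableEq ι],
      V (lp.single 2 i (1 : ℂ)) = ket (f i) := by
  classical
  have ho : Orthonormal ℂ fun i => ket (f i) := by
    rw [orthonormal_iff_ite]
    intro i j
    rw [inner_ket_ket]
    simp [hf.eq_iff]
  refine ⟨(ho.orthogonalFamily.linearIsometry).toContinuousLinearMap, ?_⟩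
  intro i inst
  have : inst = Classical.decEq _ := Subsingleton.elim _ _
  subst this
  have := ho.orthogonalFamily.linearIsometry_apply_single (i := i) (1 : ℂ)
  simpa using this

/-- Every matrix `M` acts on the subsystem `X` as a bounded operator `M ⊗ 1`. -/
theorem exists_actsAs (X : Finset ℤ) (M : Matrix (LocConf d X) (LocConf d X) ℂ) :
    ∃ T : Op d, ActsAs X M T := by
  classical
  have unit : ∀ j i : LocConf d X, ∃ T : Op d, ∀ τ,
      T (ket τ) = if restr X τ = i then ket (patch X τ j) else 0 := by
    intro j i
    let ι := {τ : Conf d // restr X τ = i}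
    obtain ⟨V, hV⟩ := exists_isometry (fun τ : ι => τ.1) Subtype.val_injective
    obtain ⟨W, hW⟩ := exists_isometry (fun τ : ι => patch X τ.1 j) (by
      rintro ⟨σ, hσ⟩ ⟨τ, hτ⟩ h
      have h2 := congrArg (fun ρ => patch X ρ i) h
      simp only [patch_patch] at h2
      apply Subtype.ext
      rw [← hσ, patch_restr, hσ, ← hτ, patch_restr] at h2
      exact h2)
    refine ⟨W.comp (ContinuousLinearMap.adjoint V), fun τ => ?_⟩
    rw [ContinuousLinearMap.comp_apply]
    have coord : ∀ σ : ι, (ContinuousLinearMap.adjoint V (ket τ)) σ =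
        if σ.1 = τ then 1 else 0 := by
      intro σ
      have h1 : ⟪lp.single 2 σ (1 : ℂ), ContinuousLinearMap.adjoint V (ket τ)⟫_ℂ
          = (ContinuousLinearMap.adjoint V (ket τ)) σ := by
        rw [lp.inner_single_left]; simp
      rw [← h1, ContinuousLinearMap.adjoint_inner_right, hV, inner_ket_ket]
    by_cases h : restr X τ = i
    · have : ContinuousLinearMap.adjoint V (ket τ) = lp.single 2 (⟨τ, h⟩ : ι) (1 : ℂ) := by
        apply lp.ext; funext σ
        rw [coord, lp.single_apply, Pi.single_apply]
        simp [Subtype.ext_iff]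
      rw [this, hW, if_pos h]
    · have : ContinuousLinearMap.adjoint V (ket τ) = 0 := by
        apply lp.ext; funext σ
        rw [coord, if_neg]
        · rfl
        · rintro rfl; exact h σ.2
      rw [this, map_zero, if_neg h]
  choose E hE using unit
  refine ⟨∑ j, ∑ i, M j i • E j i, fun τ => ?_⟩
  simp only [sum_apply, smul_apply, hE, smul_ite, smul_zero, Finset.sum_ite_eq, Finset.mem_univ,
    if_true]

/-- The observables `𝒜_X = B(⨂ x ∈ X, ℂ ^ d x)` of a finite subsystem `X`. -/
def localAlgebra (d : ℤ → ℕ) (X : Finset ℤ) : StarSubalgebra ℂ (Op d) where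
  carrier := {T | ∃ M : Matrix (LocConf d X) (LocConf d X) ℂ, ActsAs X M T}
  mul_mem' := by rintro S T ⟨M, hM⟩ ⟨N, hN⟩; exact ⟨_, hM.mul hN⟩
  add_mem' := by rintro S T ⟨M, hM⟩ ⟨N, hN⟩; exact ⟨_, hM.add hN⟩
  algebraMap_mem' := by
    intro c
    refine ⟨c • 1, ?_⟩
    rw [Algebra.algebraMap_eq_smul_one]
    exact (actsAs_one X).smul c
  star_mem' := by rintro S ⟨M, hM⟩; exact ⟨_, hM.star⟩

/-- The local observables `𝒜^loc`, the union of all `𝒜_X` with `X` finite. -/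
def localObservables (d : ℤ → ℕ) : Set (Op d) := {A | ∃ X : Finset ℤ, A ∈ localAlgebra d X}

/-- The observables `𝒜_Y` of an arbitrary subsystem `Y ⊆ ℤ`: the norm closure of the observables
in finite subsets of `Y`. -/
def regionAlgebra (d : ℤ → ℕ) (Y : Set ℤ) : StarSubalgebra ℂ (Op d) :=
  (⨆ X : {X : Finset ℤ // (X : Set ℤ) ⊆ Y}, localAlgebra d X.1).topologicalClosure

/-- The algebra `𝒜_ℤ` of quasi-local observables. -/
abbrev quasiLocal (d : ℤ → ℕ) : StarSubalgebra ℂ (Op d) := regionAlgebra d Set.univ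

/-- The commutator `[A, B]`. -/
def comm (A B : Op d) : Op d := A * B - B * A

/-- The distance `min {|x - y| : x ∈ X, y ∈ Y}` of two (nonempty) sets of sites. -/
def siteDist (X Y : Set ℤ) : ℕ := sInf {n : ℕ | ∃ x ∈ X, ∃ y ∈ Y, n = (x - y).natAbs}

/-! ### Interactions and dynamics -/

/-- An interaction assigns to each finite set `X` a self-adjoint element of `𝒜_X`. -/
structure Interaction (d : ℤ → ℕ) where
  toFun : Finset ℤ → Op d
  mem_localAlgebra : ∀ X, toFun X ∈ localAlgebra d X
  isSelfAdjoint : ∀ X, IsSelfAdjoint (toFun X)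

/-- The local Hamiltonian `H_Λ = ∑_{X ⊆ Λ} Φ(X)`. -/
def Interaction.hamiltonian (Φ : Interaction d) (Λ : Finset ℤ) : Op d :=
  ∑ X ∈ Λ.powerset, Φ.toFun X

/-- `Φ(X) = 0` unless `diam X ≤ R`. -/
def Interaction.HasRange (Φ : Interaction d) (R : ℕ) : Prop :=
  ∀ X : Finset ℤ, (∃ x ∈ X, ∃ y ∈ X, (R : ℤ) < |x - y|) → Φ.toFun X = 0

theorem Interaction.mem_quasiLocal (Φ : Interaction d) (X : Finset ℤ) :
    Φ.toFun X ∈ quasiLocal d := by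
  refine StarSubalgebra.le_topologicalClosure _ ?_
  exact le_iSup (fun X : {X : Finset ℤ // (X : Set ℤ) ⊆ Set.univ} => localAlgebra d X.1)
    ⟨X, Set.subset_univ _⟩ (Φ.mem_localAlgebra X)

/-- The energy term `h_x ∈ 𝒜_{[x, x + R]}` of an interaction of range `R`: the sum of the `Φ(X)`
over the sets `X ⊆ [x, x + R]` with leftmost site `x`. -/
def Interaction.energy (Φ : Interaction d) (R : ℕ) (x : ℤ) : quasiLocal d :=
  ∑ X ∈ (Finset.Icc x (x + R)).powerset with x ∈ X, ⟨Φ.toFun X, Φ.mem_quasiLocal X⟩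

/-- The Heisenberg dynamics `τ_t^H(A) = e^{itH} A e^{-itH}`. -/
def heisenberg (H : Op d) (t : ℝ) (A : Op d) : Op d :=
  NormedSpace.exp ((Complex.I * (t : ℂ)) • H) * A * NormedSpace.exp (-(Complex.I * (t : ℂ)) • H)

/-- The box `[-n, n]`. -/
def box (n : ℕ) : Finset ℤ := Finset.Icc (-(n : ℤ)) n

/-- `δ(A) = B`, where `δ` is the infinitesimal generator of the infinite-volume dynamics
`τ_t = e^{itδ}`. -/
def GeneratorAt (τ : ℝ → quasiLocal d ≃⋆ₐ[ℂ] quasiLocal d) (A : quasiLocal d) (B : Op d) : Prop :=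
  HasDerivAt (fun t : ℝ => (τ t A : Op d)) (Complex.I • B) 0

/-- `τ` is the thermodynamic limit of the dynamics of `Φ`: a strongly continuous one-parameter
group of `*`-automorphisms of `𝒜_ℤ` which is the strong limit of the finite-volume dynamics, and
which is generated by the derivation `δ(A) = lim_n [H_{[-n, n]}, A]` on local observables. -/
structure IsThermodynamicLimit (Φ : Interaction d)
    (τ : ℝ → quasiLocal d ≃⋆ₐ[ℂ] quasiLocal d) : Prop where
  map_zero : ∀ A, τ 0 A = A
  map_add : ∀ s t A, τ (s + t) A = τ s (τ t A)
  continuous : ∀ A, Continuous fun t => τ t A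
  tendsto : ∀ (t : ℝ) (A : quasiLocal d),
    Tendsto (fun n : ℕ => heisenberg (Φ.hamiltonian (box n)) t A) atTop (𝓝 (τ t A : Op d))
  generator : ∀ A : quasiLocal d, (A : Op d) ∈ localObservables d →
    ∃ B : Op d, Tendsto (fun n : ℕ => comm (Φ.hamiltonian (box n)) A) atTop (𝓝 B) ∧
      GeneratorAt τ A B

/-! ### Localization -/

/-- A decay function: positive, non-increasing, and tending to zero. -/
structure IsDecayFunction (F : ℕ → ℝ) : Prop where
  pos : ∀ n, 0 < F n
  antitone : Antitone F
  tendsto_zero : Tendsto F atTop (𝓝 0)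

variable {Ω : Type*} [MeasurableSpace Ω]

/-- The random variable `C_{Λ; X, Y}`, the supremum of `‖[τ_t^H(A), B]‖ / (c (1 + |t| ^ β))` over
all times `t` and all `A`, `B` in the unit balls of `𝒜_X`, `𝒜_Y`, where `H = H_Λ(ω)` and
`c = χ(|X|)`. -/
def transport (H : Op d) (c β : ℝ) (X Y : Finset ℤ) : ℝ≥0∞ :=
  ⨆ (t : ℝ) (A : Op d) (_ : A ∈ localAlgebra d X ∧ ‖A‖ ≤ 1)
    (B : Op d) (_ : B ∈ localAlgebra d Y ∧ ‖B‖ ≤ 1),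
    ENNReal.ofReal (‖comm (heisenberg H t A) B‖ / (c * (1 + |t| ^ β)))

/-- The bound `𝔼 C_{Λ; X, Y} ≤ F(d(X, Y))`, with parameters `β` and `χ`, for all finite intervals
`Λ = [a, b]` and all nonempty `X, Y ⊆ Λ` such that `Y` lies outside of `[min X, max X]`. -/
def LocalizationBound (P : Measure Ω) (H : Finset ℤ → Ω → Op d) (F : ℕ → ℝ) (β : ℝ)
    (χ : ℕ → ℝ) : Prop :=
  ∀ (a b : ℤ) (X Y : Finset ℤ), X ⊆ Finset.Icc a b → Y ⊆ Finset.Icc a b →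
    X.Nonempty → Y.Nonempty →
    (∀ y ∈ Y, (∀ x ∈ X, y < x) ∨ (∀ x ∈ X, x < y)) →
    ∫⁻ ω, transport (H (Finset.Icc a b) ω) (χ X.card) β X Y ∂P ≤
      ENNReal.ofReal (F (siteDist X Y))

/-- Dynamical localization with decay function `F`, uniformly in time (that is, with `β = 0`), of
a family of random local Hamiltonians. -/
def DynamicallyLocalizedUniformly (P : Measure Ω) (H : Finset ℤ → Ω → Op d) (F : ℕ → ℝ) : Prop :=
  IsDecayFunction F ∧ ∃ χ : ℕ → ℝ, (∀ n, 0 < χ n) ∧ LocalizationBound P H F 0 χ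

/-! ### Local integrals of motion -/

/-- `sup ‖[I, B]‖` over the unit ball of `𝒜_Y`. -/
def leakage (I : Op d) (Y : Set ℤ) : ℝ≥0∞ :=
  ⨆ (B : Op d) (_ : B ∈ regionAlgebra d Y ∧ ‖B‖ ≤ 1), ENNReal.ofReal ‖comm I B‖

/-- The family `I` of random quasi-local observables is a family of LIOMs of the second kind, for
the model with the (random) infinite-volume dynamics `τ`. -/
structure IsLIOMFamily (P : Measure Ω) (τ : Ω → ℝ → quasiLocal d ≃⋆ₐ[ℂ] quasiLocal d)
    (I : ℤ → Ω → quasiLocal d) : Prop where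
  measurable : ∀ x, StronglyMeasurable (I x)
  isSelfAdjoint : ∀ᵐ ω ∂P, ∀ x, IsSelfAdjoint (I x ω)
  bounded : ∃ K : ℝ, ∀ᵐ ω ∂P, ∀ x, ‖I x ω‖ ≤ K
  quasi_local : ∃ G : ℕ → ℝ, IsDecayFunction G ∧ ∀ (x : ℤ) (Y : Set ℤ), Y.Nonempty →
    ∫⁻ ω, leakage (I x ω : Op d) Y ∂P ≤ ENNReal.ofReal (G (siteDist {x} Y))
  invariant : ∀ᵐ ω ∂P, ∀ x, GeneratorAt (τ ω) (I x ω) 0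
  generates : ∀ᵐ ω ∂P, ∀ A : quasiLocal d, (A : Op d) ∈ localObservables d →
    ∃ B : Op d, GeneratorAt (τ ω) A B ∧
      Tendsto (fun n : ℕ => ∑ x ∈ box n, comm (I x ω : Op d) A) atTop (𝓝 B)
  same_dynamics : ∀ᵐ ω ∂P, ∀ (t : ℝ) (A : quasiLocal d),
    Tendsto (fun n : ℕ => heisenberg (∑ x ∈ box n, (I x ω : Op d)) t A) atTop
      (𝓝 (τ ω t A : Op d))

end SpinChain

end

open SpinChain

open MeasureTheory Filter Topology
open scoped InnerProductSpace ENNReal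

noncomputable section

namespace SpinChain

variable {d : ℤ → ℕ}

/-! Localization that is uniform in time keeps every evolved energy term `τ_t(h_x)` essentially
inside one fixed finite box, for all `t` at once. An observable that nearly commutes with everything
outside a box is close to an observable of that box (`exists_local_approx`), and the algebra of a
box is finite dimensional. Hence the orbit of `h_x` is totally bounded in norm
(`totallyBounded_orbit`), and a mean ergodic theorem for isometry groups (`exists_tendsto_average`)
gives norm convergence of the time averages along all integer times to an invariant element; so `T_n
= n` works.

The derivation is recovered because a finite-volume Hamiltonian is fixed by its own dynamics: `[H,
A]` is the sum of the `[τ_t(h_x), A]` up to a boundary term, with a tail over `x` that is small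
uniformly in `t`. The left side does not depend on `t`, so averaging over time replaces `τ_t(h_x)`
by its average (`tendsto_sum_comm_average`). For the dynamics, invariance of the averages commutes
them past `τ_s`, so Duhamel's estimate compares `τ_t(A)` with the evolution under the summed
averages and leaves an error `|t|` times the error in the derivation (`tendsto_heisenberg_average`).

The hypothesis bounds expectations in each finite volume separately. Fatou's lemma turns this into
almost sure control of lower limits over the volume, which is enough because the quantities to be
estimated converge with the volume (`le_of_tendsto_of_liminf_lt`). The same argument bounds the
expected leakage. The infinite-volume dynamics itself comes from a telescoping Duhamel estimate,
summable almost surely because `∑ F(n)` converges. -/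

/-! ### Local algebras: matrix units, tensor factorization, locality -/

theorem op_ext {S T : Op d} (h : ∀ τ, S (ket τ) = T (ket τ)) : S = T := by
  have key : ContinuousLinearMap.adjoint (S - T) = 0 := by
    ext1 w
    refine hil_ext fun σ => ?_
    rw [ContinuousLinearMap.adjoint_inner_right, sub_apply, h, sub_self]
    simp
  have := congrArg ContinuousLinearMap.adjoint key
  rw [ContinuousLinearMap.adjoint_adjoint, map_zero] at this
  exact sub_eq_zero.mp this

theorem ActsAs.unique {X : Finset ℤ} {M : Matrix (LocConf d X) (LocConf d X) ℂ} {S T : Op d}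
    (hS : ActsAs X M S) (hT : ActsAs X M T) : S = T :=
  op_ext fun τ => (hS τ).trans (hT τ).symm

/-- The representation `M ↦ M ⊗ 1` of the matrices on the subsystem `X`. -/
def locRep (d : ℤ → ℕ) (X : Finset ℤ) : Matrix (LocConf d X) (LocConf d X) ℂ →⋆ₐ[ℂ] Op d where
  toFun M := (exists_actsAs X M).choose
  map_one' := (exists_actsAs X 1).choose_spec.unique (actsAs_one X)
  map_mul' M N := (exists_actsAs X (M * N)).choose_spec.unique
    ((exists_actsAs X M).choose_spec.mul (exists_actsAs X N).choose_spec)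
  map_zero' := (exists_actsAs X 0).choose_spec.unique fun τ => by simp
  map_add' M N := (exists_actsAs X (M + N)).choose_spec.unique
    ((exists_actsAs X M).choose_spec.add (exists_actsAs X N).choose_spec)
  commutes' c := (exists_actsAs X _).choose_spec.unique (by
    rw [Algebra.algebraMap_eq_smul_one, Algebra.algebraMap_eq_smul_one]
    exact (actsAs_one X).smul c)
  map_star' M := (exists_actsAs X (star M)).choose_spec.unique
    (exists_actsAs X M).choose_spec.star

theorem actsAs_locRep (X : Finset ℤ) (M : Matrix (LocConf d X) (LocConf d X) ℂ) :
    ActsAs X M (locRep d X M) := (exists_actsAs X M).choose_spec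

theorem mem_localAlgebra_iff {X : Finset ℤ} {T : Op d} :
    T ∈ localAlgebra d X ↔ ∃ M, locRep d X M = T := by
  constructor
  · rintro ⟨M, hM⟩
    exact ⟨M, (actsAs_locRep X M).unique hM⟩
  · rintro ⟨M, rfl⟩
    exact ⟨M, actsAs_locRep X M⟩

theorem locRep_mem (X : Finset ℤ) (M : Matrix (LocConf d X) (LocConf d X) ℂ) :
    locRep d X M ∈ localAlgebra d X := mem_localAlgebra_iff.2 ⟨M, rfl⟩

/-- The matrix units of `𝒜_X`. -/
def matUnit {X : Finset ℤ} (j i : LocConf d X) : Op d := locRep d X (Matrix.single j i 1)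

theorem matUnit_mem {X : Finset ℤ} (j i : LocConf d X) : matUnit j i ∈ localAlgebra d X :=
  locRep_mem _ _

theorem matUnit_ket {X : Finset ℤ} (j i : LocConf d X) (τ : Conf d) :
    matUnit j i (ket τ) = if i = restr X τ then ket (patch X τ j) else 0 := by
  rw [matUnit, actsAs_locRep]
  rw [Finset.sum_eq_single j]
  · by_cases h : i = restr X τ <;> simp [h]
  · intro k _ hk
    simp [hk.symm]
  · simp

theorem locRep_eq_sum {X : Finset ℤ} (M : Matrix (LocConf d X) (LocConf d X) ℂ) :
    locRep d X M = ∑ j, ∑ i, M j i • matUnit j i := by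
  conv_lhs => rw [Matrix.matrix_eq_sum_single M]
  simp only [map_sum, matUnit]
  refine Finset.sum_congr rfl fun j _ => Finset.sum_congr rfl fun i _ => ?_
  rw [← map_smul, Matrix.smul_single, smul_eq_mul, mul_one]

theorem sum_matUnit_diag (X : Finset ℤ) : ∑ i : LocConf d X, matUnit i i = 1 := by
  refine op_ext fun τ => ?_
  simp [sum_apply, matUnit_ket, patch_restr]

/-- Restriction of a configuration on `Y` to a subset. -/
def subConf {X Y : Finset ℤ} (h : X ⊆ Y) (i : LocConf d Y) : LocConf d X :=
  fun x => i ⟨x, h x.2⟩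

theorem matUnit_union {W X : Finset ℤ} (j i : LocConf d (W ∪ X)) (hWX : Disjoint W X) :
    matUnit j i = matUnit (subConf Finset.subset_union_left j) (subConf Finset.subset_union_left i)
      * matUnit (subConf Finset.subset_union_right j) (subConf Finset.subset_union_right i) := by
  refine op_ext fun τ => ?_
  rw [mul_apply_eq_comp, matUnit_ket, matUnit_ket]
  have hiff : i = restr (W ∪ X) τ ↔ subConf Finset.subset_union_left i = restr W τ ∧
      subConf Finset.subset_union_right i = restr X τ := by
    constructor
    · rintro rfl; exact ⟨rfl, rfl⟩
    · rintro ⟨h1, h2⟩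
      funext ⟨x, hx⟩
      rcases Finset.mem_union.1 hx with h | h
      · exact congrFun h1 ⟨x, h⟩
      · exact congrFun h2 ⟨x, h⟩
  have hW : restr W (patch X τ (subConf Finset.subset_union_right j)) = restr W τ := by
    funext ⟨x, hx⟩
    have : x ∉ X := Finset.disjoint_left.1 hWX hx
    simp [restr, patch, this]
  by_cases h : subConf Finset.subset_union_right i = restr X τ
  · rw [if_pos h, matUnit_ket, hW]
    simp only [hiff, h, and_true]
    congr 2
    funext x
    by_cases hxW : x ∈ W <;> by_cases hxX : x ∈ X <;> simp [patch, subConf, hxW, hxX]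
  · rw [if_neg h, map_zero, if_neg]
    exact fun e => h (hiff.1 e).2

theorem glue_exists {W X : Finset ℤ} (hWX : Disjoint W X) (a : LocConf d W) (b : LocConf d X) :
    ∃ c : LocConf d (W ∪ X), subConf Finset.subset_union_left c = a ∧
      subConf Finset.subset_union_right c = b := by
  refine ⟨fun x => if h : x.1 ∈ W then a ⟨x, h⟩ else
    b ⟨x, (Finset.mem_union.1 x.2).resolve_left h⟩, ?_, ?_⟩
  · funext ⟨x, hx⟩
    simp [subConf, hx]
  · funext ⟨x, hx⟩
    have : x ∉ W := Finset.disjoint_right.1 hWX hx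
    simp [subConf, this]

/-- Tensoring with the identity of `X` means summing over the diagonal matrix units of `X`; each
product of matrix units on `W` and `X` is a matrix unit of the union. -/
theorem localAlgebra_le_union {W X : Finset ℤ} (hWX : Disjoint W X) :
    localAlgebra d W ≤ localAlgebra d (W ∪ X) := by
  intro T hT
  obtain ⟨M, rfl⟩ := mem_localAlgebra_iff.1 hT
  rw [locRep_eq_sum]
  refine sum_mem fun j _ => sum_mem fun i _ => SMulMemClass.smul_mem _ ?_
  rw [← mul_one (matUnit j i), ← sum_matUnit_diag X, Finset.mul_sum]
  refine sum_mem fun k _ => ?_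
  obtain ⟨j', h1, h2⟩ := glue_exists hWX j k
  obtain ⟨i', h3, h4⟩ := glue_exists hWX i k
  have := matUnit_union j' i' hWX
  rw [h1, h2, h3, h4] at this
  rw [← this]
  exact matUnit_mem _ _

theorem localAlgebra_mono {X Y : Finset ℤ} (h : X ⊆ Y) : localAlgebra d X ≤ localAlgebra d Y := by
  have := localAlgebra_le_union (d := d) (W := X) (X := Y \ X) Finset.disjoint_sdiff
  rwa [Finset.union_sdiff_of_subset h] at this

/-- The algebra of a disjoint union is spanned by products, so linear properties need only be
checked on product observables. -/
theorem localAlgebra_union_induction {W X : Finset ℤ} (hWX : Disjoint W X) {p : Op d → Prop}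
    (hadd : ∀ S T, p S → p T → p (S + T)) (hsmul : ∀ (c : ℂ) S, p S → p (c • S)) (hzero : p 0)
    (hmul : ∀ S ∈ localAlgebra d W, ∀ T ∈ localAlgebra d X, p (S * T)) {T : Op d}
    (hT : T ∈ localAlgebra d (W ∪ X)) : p T := by
  obtain ⟨M, rfl⟩ := mem_localAlgebra_iff.1 hT
  rw [locRep_eq_sum]
  refine Finset.sum_induction _ p hadd hzero fun j _ =>
    Finset.sum_induction _ p hadd hzero fun i _ => hsmul _ _ ?_
  rw [matUnit_union _ _ hWX]
  exact hmul _ (matUnit_mem _ _) _ (matUnit_mem _ _)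

theorem commute_of_disjoint {X Y : Finset ℤ} (h : Disjoint X Y) {S T : Op d}
    (hS : S ∈ localAlgebra d X) (hT : T ∈ localAlgebra d Y) : Commute S T := by
  obtain ⟨M, hM⟩ := hS
  obtain ⟨N, hN⟩ := hT
  have hr : ∀ {X Y : Finset ℤ}, Disjoint X Y → ∀ (τ : Conf d) (j : LocConf d Y),
      restr X (patch Y τ j) = restr X τ := by
    intro X Y h τ j
    funext ⟨x, hx⟩
    have : x ∉ Y := Finset.disjoint_left.1 h hx
    simp [restr, patch, this]
  refine op_ext fun τ => ?_
  rw [mul_apply_eq_comp, mul_apply_eq_comp, hM τ, hN τ, map_sum, map_sum]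
  simp only [map_smul, hM _, hN _, hr h, hr h.symm, Finset.smul_sum, smul_smul]
  rw [Finset.sum_comm]
  refine Finset.sum_congr rfl fun i _ => Finset.sum_congr rfl fun j _ => ?_
  rw [mul_comm]
  congr 2
  funext x
  by_cases hx : x ∈ X
  · have : x ∉ Y := Finset.disjoint_left.1 h hx
    simp [patch, hx, this]
  · simp [patch, hx]

theorem finiteDimensional_localAlgebra (X : Finset ℤ) :
    FiniteDimensional ℂ (Subalgebra.toSubmodule (localAlgebra d X).toSubalgebra) := by
  have : Subalgebra.toSubmodule (localAlgebra d X).toSubalgebra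
      = LinearMap.range ((locRep d X : Matrix (LocConf d X) (LocConf d X) ℂ →ₐ[ℂ] Op d).toLinearMap) := by
    ext T
    exact mem_localAlgebra_iff
  rw [this]
  infer_instance

theorem properSpace_localAlgebra (X : Finset ℤ) : ProperSpace (localAlgebra d X) := by
  have := finiteDimensional_localAlgebra (d := d) X
  exact FiniteDimensional.proper ℂ (Subalgebra.toSubmodule (localAlgebra d X).toSubalgebra)

theorem isSeparable_localAlgebra (X : Finset ℤ) :
    TopologicalSpace.IsSeparable (localAlgebra d X : Set (Op d)) := by
  have := properSpace_localAlgebra (d := d) X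
  exact TopologicalSpace.IsSeparable.of_subtype (localAlgebra d X : Set (Op d))

theorem localAlgebra_le_regionAlgebra {X : Finset ℤ} {Y : Set ℤ} (h : (X : Set ℤ) ⊆ Y) :
    localAlgebra d X ≤ regionAlgebra d Y :=
  le_trans (le_iSup (fun X : {X : Finset ℤ // (X : Set ℤ) ⊆ Y} => localAlgebra d X.1) ⟨X, h⟩)
    (StarSubalgebra.le_topologicalClosure _)

theorem localAlgebra_le_quasiLocal (X : Finset ℤ) : localAlgebra d X ≤ quasiLocal d :=
  localAlgebra_le_regionAlgebra (Set.subset_univ _)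

/-- The family of local algebras is directed, so their supremum is a plain union and density
arguments need no algebraic closure. -/
theorem mem_regionAlgebra_iff {Y : Set ℤ} {T : Op d} : T ∈ regionAlgebra d Y ↔
    T ∈ closure {S : Op d | ∃ X : Finset ℤ, (X : Set ℤ) ⊆ Y ∧ S ∈ localAlgebra d X} := by
  have hdir : Directed (· ≤ ·) fun X : {X : Finset ℤ // (X : Set ℤ) ⊆ Y} => localAlgebra d X.1 := by
    intro X Z
    refine ⟨⟨X.1 ∪ Z.1, ?_⟩, localAlgebra_mono Finset.subset_union_left,
      localAlgebra_mono Finset.subset_union_right⟩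
    rw [Finset.coe_union]
    exact Set.union_subset X.2 Z.2
  have hne : Nonempty {X : Finset ℤ // (X : Set ℤ) ⊆ Y} := ⟨⟨∅, by simp⟩⟩
  rw [regionAlgebra, ← SetLike.mem_coe, StarSubalgebra.topologicalClosure_coe,
    StarSubalgebra.coe_iSup_of_directed hdir]
  have : (⋃ X : {X : Finset ℤ // (X : Set ℤ) ⊆ Y}, (localAlgebra d X.1 : Set (Op d)))
      = {S : Op d | ∃ X : Finset ℤ, (X : Set ℤ) ⊆ Y ∧ S ∈ localAlgebra d X} := by
    ext S
    simp
  rw [this]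

theorem regionAlgebra_induction {Y : Set ℤ} {p : Op d → Prop} (hp : IsClosed {T | p T})
    (h : ∀ X : Finset ℤ, (X : Set ℤ) ⊆ Y → ∀ T ∈ localAlgebra d X, p T) {T : Op d}
    (hT : T ∈ regionAlgebra d Y) : p T := by
  rw [mem_regionAlgebra_iff] at hT
  refine closure_minimal ?_ hp hT
  rintro S ⟨X, hX, hS⟩
  exact h X hX S hS

theorem isClosed_quasiLocal : IsClosed (quasiLocal d : Set (Op d)) :=
  StarSubalgebra.isClosed_topologicalClosure _

theorem completeSpace_quasiLocal : CompleteSpace (quasiLocal d) :=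
  isClosed_quasiLocal.completeSpace_coe

theorem subset_box (X : Finset ℤ) : ∃ k, X ⊆ box k := by
  refine ⟨X.sup Int.natAbs, fun x hx => ?_⟩
  have : x.natAbs ≤ X.sup Int.natAbs := Finset.le_sup (f := Int.natAbs) hx
  rw [box, Finset.mem_Icc]
  omega

theorem box_mono {m n : ℕ} (h : m ≤ n) : box m ⊆ box n := by
  intro x hx
  rw [box, Finset.mem_Icc] at *
  omega

theorem quasiLocal_induction {p : Op d → Prop} (hp : IsClosed {T | p T})
    (h : ∀ k, ∀ T ∈ localAlgebra d (box k), p T) {T : Op d} (hT : T ∈ quasiLocal d) : p T := by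
  refine regionAlgebra_induction hp (fun X _ T hT => ?_) hT
  obtain ⟨k, hk⟩ := subset_box X
  exact h k T (localAlgebra_mono hk hT)

theorem comm_eq_zero_of_disjoint {X Y : Finset ℤ} (h : Disjoint X Y) {S T : Op d}
    (hS : S ∈ localAlgebra d X) (hT : T ∈ localAlgebra d Y) : comm S T = 0 :=
  sub_eq_zero.2 (commute_of_disjoint h hS hT)

theorem norm_comm_le (A B : Op d) : ‖comm A B‖ ≤ 2 * ‖A‖ * ‖B‖ := by
  have h1 := norm_mul_le A B
  have h2 := norm_mul_le B A
  have h3 := norm_sub_le (A * B) (B * A)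
  rw [comm]
  nlinarith

theorem norm_comm_swap (A B : Op d) : ‖comm A B‖ = ‖comm B A‖ := by
  rw [comm, comm, norm_sub_rev]

theorem continuous_comm : Continuous fun p : Op d × Op d => comm p.1 p.2 := by
  unfold comm
  fun_prop

theorem norm_comm_le_of_mem_regionAlgebra {T : Op d} {Y : Set ℤ} {c : ℝ}
    (h : ∀ X : Finset ℤ, (X : Set ℤ) ⊆ Y → ∀ B ∈ localAlgebra d X, ‖comm T B‖ ≤ c * ‖B‖)
    {B : Op d} (hB : B ∈ regionAlgebra d Y) : ‖comm T B‖ ≤ c * ‖B‖ := by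
  refine regionAlgebra_induction (p := fun B => ‖comm T B‖ ≤ c * ‖B‖) ?_ h hB
  refine isClosed_le ?_ (by fun_prop)
  unfold comm
  fun_prop

/-! ### Finite-volume Heisenberg dynamics and Duhamel estimates -/

/-- The unitary group `e^{itH}`. -/
def evol (H : Op d) (t : ℝ) : Op d := NormedSpace.exp (t • (Complex.I • H))

theorem heisenberg_eq (H : Op d) (t : ℝ) (A : Op d) :
    heisenberg H t A = evol H t * A * evol H (-t) := by
  have h : ∀ t : ℝ, (Complex.I * (t : ℂ)) • H = t • (Complex.I • H) := by
    intro t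
    rw [mul_comm, mul_smul]
    rfl
  rw [heisenberg, evol, evol, h, ← h (-t)]
  congr 3
  simp

theorem evol_zero (H : Op d) : evol H 0 = 1 := by simp [evol]

theorem evol_add (H : Op d) (s t : ℝ) : evol H (s + t) = evol H s * evol H t := by
  let +nondep : NormedAlgebra ℚ (Op d) := NormedAlgebra.restrictScalars ℚ ℂ (Op d)
  rw [evol, add_smul, NormedSpace.exp_add_of_commute]
  · rfl
  · exact ((Commute.refl _).smul_left _).smul_right _

theorem evol_mul_neg (H : Op d) (t : ℝ) : evol H t * evol H (-t) = 1 := by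
  rw [← evol_add, add_neg_cancel, evol_zero]

theorem evol_neg_mul (H : Op d) (t : ℝ) : evol H (-t) * evol H t = 1 := by
  rw [← evol_add, neg_add_cancel, evol_zero]

theorem evol_neg_left (H : Op d) (t : ℝ) : evol (-H) t = evol H (-t) := by
  simp [evol]

theorem star_evol {H : Op d} (hH : IsSelfAdjoint H) (t : ℝ) : star (evol H t) = evol H (-t) := by
  have h : ∀ t : ℝ, t • (Complex.I • H) = (t : ℂ) • (Complex.I • H) := fun _ => rfl
  rw [evol, evol, NormedSpace.star_exp, h, h, star_smul, star_smul, hH.star_eq]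
  simp

theorem evol_mem_unitary {H : Op d} (hH : IsSelfAdjoint H) (t : ℝ) :
    evol H t ∈ unitary (Op d) := by
  rw [Unitary.mem_iff, star_evol hH]
  exact ⟨evol_neg_mul H t, evol_mul_neg H t⟩

theorem hasDerivAt_evol (H : Op d) (t : ℝ) :
    HasDerivAt (evol H) (evol H t * (Complex.I • H)) t :=
  hasDerivAt_exp_smul_const (𝕂 := ℝ) (Complex.I • H) t

theorem hasDerivAt_evol' (H : Op d) (t : ℝ) :
    HasDerivAt (evol H) ((Complex.I • H) * evol H t) t :=
  hasDerivAt_exp_smul_const' (𝕂 := ℝ) (Complex.I • H) t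

theorem continuous_evol : Continuous fun p : Op d × ℝ => evol p.1 p.2 := by
  let +nondep : NormedAlgebra ℚ (Op d) := NormedAlgebra.restrictScalars ℚ ℂ (Op d)
  unfold evol
  exact NormedSpace.exp_continuous.comp (by fun_prop)

theorem continuous_heisenberg : Continuous fun p : Op d × ℝ × Op d => heisenberg p.1 p.2.1 p.2.2 := by
  simp only [heisenberg_eq]
  have h1 : Continuous fun p : Op d × ℝ × Op d => evol p.1 p.2.1 :=
    continuous_evol.comp (by fun_prop : Continuous fun p : Op d × ℝ × Op d => (p.1, p.2.1))
  have h2 : Continuous fun p : Op d × ℝ × Op d => evol p.1 (-p.2.1) :=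
    continuous_evol.comp (by fun_prop : Continuous fun p : Op d × ℝ × Op d => (p.1, -p.2.1))
  fun_prop

theorem evol_mem {S : StarSubalgebra ℂ (Op d)} (hS : IsClosed (S : Set (Op d))) {H : Op d}
    (hH : H ∈ S) (t : ℝ) : evol H t ∈ S := by
  refine NormedSpace.exp_mem (R := ℂ) hS ?_
  exact SMulMemClass.smul_mem (t : ℂ) (SMulMemClass.smul_mem _ hH)

theorem heisenberg_mem {S : StarSubalgebra ℂ (Op d)} (hS : IsClosed (S : Set (Op d))) {H A : Op d}
    (hH : H ∈ S) (hA : A ∈ S) (t : ℝ) : heisenberg H t A ∈ S := by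
  rw [heisenberg_eq]
  exact mul_mem (mul_mem (evol_mem hS hH t) hA) (evol_mem hS hH _)

theorem heisenberg_zero_time (H A : Op d) : heisenberg H 0 A = A := by
  simp [heisenberg_eq, evol_zero]

theorem heisenberg_add_time (H : Op d) (s t : ℝ) (A : Op d) :
    heisenberg H (s + t) A = heisenberg H s (heisenberg H t A) := by
  simp only [heisenberg_eq, evol_add, neg_add, mul_assoc]
  rw [← evol_add, ← evol_add, add_comm (-s)]

theorem heisenberg_neg_left (H : Op d) (t : ℝ) (A : Op d) :
    heisenberg (-H) t A = heisenberg H (-t) A := by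
  simp [heisenberg_eq, evol_neg_left]

theorem heisenberg_mul (H : Op d) (t : ℝ) (A B : Op d) :
    heisenberg H t (A * B) = heisenberg H t A * heisenberg H t B := by
  simp only [heisenberg_eq, mul_assoc]
  rw [← mul_assoc (evol H (-t)) (evol H t), evol_neg_mul, one_mul]

theorem heisenberg_add (H : Op d) (t : ℝ) (A B : Op d) :
    heisenberg H t (A + B) = heisenberg H t A + heisenberg H t B := by
  simp only [heisenberg_eq, mul_add, add_mul]

theorem heisenberg_sub (H : Op d) (t : ℝ) (A B : Op d) :
    heisenberg H t (A - B) = heisenberg H t A - heisenberg H t B := by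
  simp only [heisenberg_eq, mul_sub, sub_mul]

theorem heisenberg_smul (H : Op d) (t : ℝ) (c : ℂ) (A : Op d) :
    heisenberg H t (c • A) = c • heisenberg H t A := by
  simp only [heisenberg_eq, mul_smul_comm, smul_mul_assoc]

theorem heisenberg_sum (H : Op d) (t : ℝ) {ι : Type*} (s : Finset ι) (A : ι → Op d) :
    heisenberg H t (∑ i ∈ s, A i) = ∑ i ∈ s, heisenberg H t (A i) := by
  simp only [heisenberg_eq, Finset.mul_sum, Finset.sum_mul]

theorem heisenberg_star {H : Op d} (hH : IsSelfAdjoint H) (t : ℝ) (A : Op d) :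
    heisenberg H t (star A) = star (heisenberg H t A) := by
  simp only [heisenberg_eq, star_mul, star_evol hH, neg_neg, mul_assoc]

theorem norm_heisenberg {H : Op d} (hH : IsSelfAdjoint H) (t : ℝ) (A : Op d) :
    ‖heisenberg H t A‖ = ‖A‖ := by
  rw [heisenberg_eq, CStarRing.norm_mul_mem_unitary _ (evol_mem_unitary hH _),
    CStarRing.norm_mem_unitary_mul _ (evol_mem_unitary hH _)]

theorem commute_evol {H A : Op d} (h : Commute H A) (t : ℝ) : Commute (evol H t) A :=
  ((h.smul_left _).smul_left _).exp_left

theorem heisenberg_self (H : Op d) (t : ℝ) : heisenberg H t H = H := by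
  rw [heisenberg_eq, (commute_evol (Commute.refl H) t).eq, mul_assoc, evol_mul_neg, mul_one]

theorem heisenberg_comm (H : Op d) (t : ℝ) (A B : Op d) :
    heisenberg H t (comm A B) = comm (heisenberg H t A) (heisenberg H t B) := by
  simp only [comm, heisenberg_sub, heisenberg_mul]

/-- Evolving the whole commutator backwards moves the dynamics onto the other factor. This bounds
evolved energy terms far away by the transport out of the fixed box that carries `A`. -/
theorem norm_comm_heisenberg {H : Op d} (hH : IsSelfAdjoint H) (t : ℝ) (A B : Op d) :
    ‖comm (heisenberg H t A) B‖ = ‖comm (heisenberg H (-t) B) A‖ := by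
  rw [← norm_heisenberg hH (-t), heisenberg_comm, ← heisenberg_add_time, neg_add_cancel,
    heisenberg_zero_time, norm_comm_swap]

theorem hasDerivAt_heisenberg_comp (H : Op d) {f : ℝ → Op d} {f' : Op d} {t : ℝ}
    (hf : HasDerivAt f f' t) : HasDerivAt (fun s => heisenberg H s (f s))
      (heisenberg H t (f' + Complex.I • comm H (f t))) t := by
  have h := ((hasDerivAt_evol H t).mul hf).mul ((hasDerivAt_evol' (-H) t))
  have he : evol H * f * evol (-H) = fun s => heisenberg H s (f s) := by
    funext s
    simp only [Pi.mul_apply, heisenberg_eq, evol_neg_left]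
  rw [he] at h
  simp only [heisenberg_eq, evol_neg_left, Pi.mul_apply] at h ⊢
  refine h.congr_deriv ?_
  simp only [comm, smul_sub, mul_add, add_mul, mul_sub, sub_mul, smul_neg, mul_neg, neg_mul,
    smul_mul_assoc, mul_smul_comm, mul_assoc]
  abel

theorem hasDerivAt_heisenberg (H A : Op d) (t : ℝ) : HasDerivAt (fun s => heisenberg H s A)
      (heisenberg H t (Complex.I • comm H A)) t := by
  simpa using hasDerivAt_heisenberg_comp H (hasDerivAt_const t A)

/-- Duhamel's estimate. -/
theorem norm_sub_heisenberg_le {H : Op d} (hH : IsSelfAdjoint H) {f f' : ℝ → Op d} {c : ℝ}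
    (hf : ∀ s, HasDerivAt f (f' s) s) (hc : ∀ s, ‖f' s - Complex.I • comm H (f s)‖ ≤ c) (t : ℝ) :
    ‖f t - heisenberg H t (f 0)‖ ≤ c * |t| := by
  -- Undoing the `H`-evolution along `f` gives a curve whose derivative is the evolved defect of the
  -- Heisenberg equation, and the evolution preserves its norm.
  have h := Convex.norm_image_sub_le_of_norm_hasDerivWithin_le (s := Set.univ) (C := c)
    (x := 0) (y := t)
    (fun s _ => (hasDerivAt_heisenberg_comp (-H) (hf s)).hasDerivWithinAt) (fun s _ => by
      rw [norm_heisenberg hH.neg]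
      refine le_trans (le_of_eq ?_) (hc s)
      congr 1
      simp only [comm, neg_mul, mul_neg, smul_sub, smul_neg]
      abel) convex_univ (Set.mem_univ _) (Set.mem_univ _)
  rw [sub_zero, Real.norm_eq_abs, heisenberg_zero_time, heisenberg_neg_left] at h
  refine le_trans (le_of_eq ?_) h
  rw [← norm_heisenberg hH (-t), heisenberg_sub, ← heisenberg_add_time, neg_add_cancel,
    heisenberg_zero_time]

/-- Duhamel with the `H'`-orbit of `A` as the curve: its defect in the equation of `H` is the
commutator with `H' - H`. Only the evolved `A` against a fixed perturbation appears, which is the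
form localization controls. -/
theorem norm_heisenberg_sub_heisenberg_le {H H' : Op d} (hH : IsSelfAdjoint H) {A : Op d}
    {c : ℝ} (hc : ∀ s, ‖comm (heisenberg H' s A) (H' - H)‖ ≤ c) (t : ℝ) :
    ‖heisenberg H' t A - heisenberg H t A‖ ≤ c * |t| := by
  have h := norm_sub_heisenberg_le hH (c := c) (fun s => hasDerivAt_heisenberg H' A s) (fun s => by
    refine le_trans (le_of_eq ?_) (hc s)
    have : heisenberg H' s (Complex.I • comm H' A) - Complex.I • comm H (heisenberg H' s A)
        = Complex.I • comm (H' - H) (heisenberg H' s A) := by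
      rw [heisenberg_smul, heisenberg_comm, heisenberg_self, ← smul_sub]
      congr 1
      simp only [comm, sub_mul, mul_sub]
      abel
    rw [this, norm_smul, Complex.norm_I, one_mul, norm_comm_swap]) t
  rwa [heisenberg_zero_time] at h

theorem norm_heisenberg_sub_self_le {H : Op d} (hH : IsSelfAdjoint H) (A : Op d) (t : ℝ) :
    ‖heisenberg H t A - A‖ ≤ ‖comm H A‖ * |t| := by
  have h := Convex.norm_image_sub_le_of_norm_hasDerivWithin_le (s := Set.univ) (C := ‖comm H A‖)
    (x := 0) (y := t) (fun s _ => (hasDerivAt_heisenberg H A s).hasDerivWithinAt) (fun s _ => by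
      rw [norm_heisenberg hH, norm_smul, Complex.norm_I, one_mul])
    convex_univ (Set.mem_univ _) (Set.mem_univ _)
  rwa [sub_zero, heisenberg_zero_time, Real.norm_eq_abs] at h

/-- The remainder constant is a double commutator. For finite-range interactions and local `A` it
eventually stops depending on the volume, so the bound survives the thermodynamic limit. -/
theorem norm_heisenberg_sub_linear_le {H : Op d} (hH : IsSelfAdjoint H) (A : Op d) (t : ℝ) :
    ‖heisenberg H t A - A - t • (Complex.I • comm H A)‖ ≤ ‖comm H (comm H A)‖ * t ^ 2 := by
  have h := Convex.norm_image_sub_le_of_norm_hasDerivWithin_le (s := Set.uIcc 0 t)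
    (C := ‖comm H (comm H A)‖ * |t|) (x := 0) (y := t)
    (fun s _ => ((hasDerivAt_heisenberg H A s).sub
      ((hasDerivAt_id s).smul_const (Complex.I • comm H A))).hasDerivWithinAt) (fun s hs => by
      rw [one_smul, heisenberg_smul, ← smul_sub, norm_smul, Complex.norm_I, one_mul]
      refine (norm_heisenberg_sub_self_le hH _ s).trans ?_
      have := Set.abs_sub_left_of_mem_uIcc hs
      rw [sub_zero, sub_zero] at this
      exact mul_le_mul_of_nonneg_left this (norm_nonneg _))
    (convex_uIcc 0 t) Set.left_mem_uIcc Set.right_mem_uIcc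
  simp only [Pi.sub_apply, id, heisenberg_zero_time, zero_smul, sub_zero] at h
  rw [Real.norm_eq_abs, mul_assoc, abs_mul_abs_self, ← pow_two] at h
  rwa [sub_right_comm]

/-! ### Existence of the thermodynamic limit and its generator -/

/-- A sequence of Hamiltonians whose dynamics converge in the thermodynamic limit. -/
structure ConvergentHamiltonians (H : ℕ → Op d) : Prop where
  isSelfAdjoint : ∀ n, IsSelfAdjoint (H n)
  mem : ∀ n, H n ∈ quasiLocal d
  summable : ∀ k, ∃ c : ℕ → ℝ, Summable c ∧ ∀ᶠ n in atTop, ∀ s, ∀ A ∈ localAlgebra d (box k),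
    ‖comm (heisenberg (H (n + 1)) s A) (H (n + 1) - H n)‖ ≤ c n * ‖A‖
  derivation : ∀ A ∈ localObservables d, ∃ B ∈ localObservables d,
    ∀ᶠ n in atTop, comm (H n) A = B

namespace ConvergentHamiltonians

variable {H : ℕ → Op d}

theorem cauchySeq_local (hH : ConvergentHamiltonians H) (t : ℝ) {k : ℕ} {A : Op d}
    (hA : A ∈ localAlgebra d (box k)) : CauchySeq fun n => heisenberg (H n) t A := by
  obtain ⟨c, hc, hb⟩ := hH.summable k
  obtain ⟨N, hN⟩ := eventually_atTop.1 hb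
  rw [← cauchySeq_shift N]
  refine cauchySeq_of_dist_le_of_summable (fun n => c (n + N) * (‖A‖ * |t|)) (fun n => ?_) ?_
  · rw [dist_comm, dist_eq_norm, Nat.succ_eq_add_one, Nat.add_right_comm, ← mul_assoc]
    exact norm_heisenberg_sub_heisenberg_le (hH.isSelfAdjoint _)
      (fun s => hN (n + N) (by omega) s A hA) t
  · exact ((summable_nat_add_iff N).2 hc).mul_right _

theorem cauchySeq (hH : ConvergentHamiltonians H) (t : ℝ) {A : Op d} (hA : A ∈ quasiLocal d) :
    CauchySeq fun n => heisenberg (H n) t A := by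
  refine quasiLocal_induction (p := fun A => CauchySeq fun n => heisenberg (H n) t A) ?_
    (fun k T hT => hH.cauchySeq_local t hT) hA
  refine isClosed_of_closure_subset fun A hA => ?_
  rw [Metric.mem_closure_iff] at hA
  rw [Set.mem_ofPred_eq, Metric.cauchySeq_iff]
  intro ε hε
  obtain ⟨B, hB, hAB⟩ := hA (ε / 3) (by positivity)
  obtain ⟨N, hN⟩ := Metric.cauchySeq_iff.1 hB (ε / 3) (by positivity)
  refine ⟨N, fun m hm n hn => ?_⟩
  have hd : ∀ n, dist (heisenberg (H n) t A) (heisenberg (H n) t B) < ε / 3 := by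
    intro n
    rwa [dist_eq_norm, ← heisenberg_sub, norm_heisenberg (hH.isSelfAdjoint n), ← dist_eq_norm]
  have h1 := dist_triangle4 (heisenberg (H m) t A) (heisenberg (H m) t B)
    (heisenberg (H n) t B) (heisenberg (H n) t A)
  have h2 := hd m
  have h3 := hd n
  rw [dist_comm] at h3
  have h4 := hN m hm n hn
  linarith

theorem exists_limit (hH : ConvergentHamiltonians H) (t : ℝ) (A : quasiLocal d) :
    ∃ L : quasiLocal d, Tendsto (fun n => heisenberg (H n) t A) atTop (𝓝 (L : Op d)) := by
  obtain ⟨L, hL⟩ := cauchySeq_tendsto_of_complete (hH.cauchySeq t A.2)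
  exact ⟨⟨L, isClosed_quasiLocal.mem_of_tendsto hL (Eventually.of_forall fun n =>
    heisenberg_mem isClosed_quasiLocal (hH.mem n) A.2 t)⟩, hL⟩

/-- The thermodynamic limit of the dynamics. -/
def limit (hH : ConvergentHamiltonians H) (t : ℝ) (A : quasiLocal d) : quasiLocal d :=
  (hH.exists_limit t A).choose

theorem tendsto_limit (hH : ConvergentHamiltonians H) (t : ℝ) (A : quasiLocal d) :
    Tendsto (fun n => heisenberg (H n) t A) atTop (𝓝 (hH.limit t A : Op d)) :=
  (hH.exists_limit t A).choose_spec

theorem limit_eq (hH : ConvergentHamiltonians H) {t : ℝ} {A L : quasiLocal d}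
    (h : Tendsto (fun n => heisenberg (H n) t A) atTop (𝓝 (L : Op d))) : hH.limit t A = L :=
  Subtype.ext (tendsto_nhds_unique (hH.tendsto_limit t A) h)

theorem limit_zero (hH : ConvergentHamiltonians H) (A : quasiLocal d) : hH.limit 0 A = A :=
  hH.limit_eq (by simp only [heisenberg_zero_time]; exact tendsto_const_nhds)

theorem limit_add_time (hH : ConvergentHamiltonians H) (s t : ℝ) (A : quasiLocal d) :
    hH.limit (s + t) A = hH.limit s (hH.limit t A) := by
  refine hH.limit_eq ?_
  have h1 := hH.tendsto_limit s (hH.limit t A)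
  have h2 := hH.tendsto_limit t A
  refine tendsto_of_tendsto_of_dist h1 ?_
  rw [tendsto_iff_dist_tendsto_zero] at h2
  refine h2.congr fun n => ?_
  rw [heisenberg_add_time, dist_comm, dist_eq_norm, dist_eq_norm, ← heisenberg_sub,
    norm_heisenberg (hH.isSelfAdjoint n)]

/-- The thermodynamic limit as a `*`-automorphism. -/
def limitEquiv (hH : ConvergentHamiltonians H) (t : ℝ) : quasiLocal d ≃⋆ₐ[ℂ] quasiLocal d where
  toFun := hH.limit t
  invFun := hH.limit (-t)
  left_inv A := by rw [← hH.limit_add_time, neg_add_cancel, hH.limit_zero]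
  right_inv A := by rw [← hH.limit_add_time, add_neg_cancel, hH.limit_zero]
  map_mul' A B := hH.limit_eq (by
    simp only [MulMemClass.coe_mul, heisenberg_mul]
    exact (hH.tendsto_limit t A).mul (hH.tendsto_limit t B))
  map_add' A B := hH.limit_eq (by
    simp only [AddMemClass.coe_add, heisenberg_add]
    exact (hH.tendsto_limit t A).add (hH.tendsto_limit t B))
  map_star' A := hH.limit_eq (by
    simp only [StarMemClass.coe_star, heisenberg_star (hH.isSelfAdjoint _)]
    exact (hH.tendsto_limit t A).star)
  map_smul' c A := hH.limit_eq (by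
    simp only [SetLike.val_smul, heisenberg_smul]
    exact (hH.tendsto_limit t A).const_smul c)

theorem norm_limit (hH : ConvergentHamiltonians H) (t : ℝ) (A : quasiLocal d) :
    ‖hH.limit t A‖ = ‖A‖ := by
  refine tendsto_nhds_unique (hH.tendsto_limit t A).norm ?_
  simp only [norm_heisenberg (hH.isSelfAdjoint _)]
  exact tendsto_const_nhds

theorem norm_limit_sub_le (hH : ConvergentHamiltonians H) {A : quasiLocal d} {B : Op d}
    (hB : ∀ᶠ n in atTop, comm (H n) A = B) (t : ℝ) :
    ‖(hH.limit t A : Op d) - A‖ ≤ ‖B‖ * |t| := by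
  refine le_of_tendsto ((hH.tendsto_limit t A).sub_const _).norm ?_
  filter_upwards [hB] with n hn
  rw [← hn]
  exact norm_heisenberg_sub_self_le (hH.isSelfAdjoint n) _ t

/-- For local `A` the orbit is Lipschitz: near time zero the speed is at most the norm of the
stabilized commutator, and the isometric group law carries this to all times. Density does the rest.
-/
theorem continuous_limit (hH : ConvergentHamiltonians H) (A : quasiLocal d) :
    Continuous fun t => hH.limit t A := by
  rw [continuous_induced_rng]
  have hsub : ∀ t (A B : quasiLocal d), hH.limit t A - hH.limit t B = hH.limit t (A - B) :=
    fun t A B => (map_sub (hH.limitEquiv t) A B).symm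
  -- Membership is bundled into the predicate so that the induction principle, which speaks of
  -- elements of `Op d`, can be applied to a map defined only on `quasiLocal d`.
  have key : ∀ A ∈ quasiLocal d, ∃ hA : A ∈ quasiLocal d,
      Continuous fun t => (hH.limit t ⟨A, hA⟩ : Op d) := by
    intro A hA
    refine quasiLocal_induction (p := fun A => ∃ hA : A ∈ quasiLocal d,
      Continuous fun t => (hH.limit t ⟨A, hA⟩ : Op d)) ?_ ?_ hA
    · refine isClosed_of_closure_subset fun A hA => ?_
      have hA' : A ∈ quasiLocal d :=
        closure_minimal (fun B hB => hB.choose) isClosed_quasiLocal hA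
      refine ⟨hA', ?_⟩
      rw [Metric.mem_closure_iff] at hA
      refine continuous_iff_continuousAt.2 fun t => Metric.continuousAt_iff'.2 fun ε hε => ?_
      obtain ⟨B, ⟨hB, hBc⟩, hAB⟩ := hA (ε / 3) (by positivity)
      have hd : ∀ t, dist (hH.limit t ⟨A, hA'⟩ : Op d) (hH.limit t ⟨B, hB⟩ : Op d) < ε / 3 := by
        intro t
        rw [dist_eq_norm] at hAB ⊢
        rw [← AddSubgroupClass.coe_sub, hsub]
        exact (hH.norm_limit t _).trans_lt hAB
      filter_upwards [Metric.continuousAt_iff'.1 hBc.continuousAt (ε / 3) (by positivity)] with s hs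
      have h1 := dist_triangle4 (hH.limit s ⟨A, hA'⟩ : Op d) (hH.limit s ⟨B, hB⟩ : Op d)
        (hH.limit t ⟨B, hB⟩ : Op d) (hH.limit t ⟨A, hA'⟩ : Op d)
      have h2 := hd s
      have h3 := hd t
      rw [dist_comm] at h3
      linarith
    · intro k A hAk
      have hA := localAlgebra_le_quasiLocal _ hAk
      refine ⟨hA, ?_⟩
      obtain ⟨B, -, hB⟩ := hH.derivation A ⟨_, hAk⟩
      rw [Metric.continuous_iff]
      intro t ε hε
      refine ⟨ε / (‖B‖ + 1), by positivity, fun s hs => ?_⟩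
      rw [dist_eq_norm] at hs ⊢
      have e : hH.limit s ⟨A, hA⟩ = hH.limit t (hH.limit (s - t) ⟨A, hA⟩) := by
        rw [← hH.limit_add_time]; congr 1; ring
      rw [e, ← AddSubgroupClass.coe_sub, hsub]
      have h1 := hH.norm_limit t (hH.limit (s - t) ⟨A, hA⟩ - ⟨A, hA⟩)
      have h2 := hH.norm_limit_sub_le (A := ⟨A, hA⟩) hB (s - t)
      have h3 : |s - t| * (‖B‖ + 1) < ε := (lt_div_iff₀ (by positivity)).1 hs
      calc _ = ‖hH.limit t (hH.limit (s - t) ⟨A, hA⟩ - ⟨A, hA⟩)‖ := rfl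
        _ = _ := h1
        _ ≤ ‖B‖ * |s - t| := h2
        _ < ε := by nlinarith [abs_nonneg (s - t)]
  exact (key A A.2).choose_spec

/-- Both `[H_n, A]` and `[H_n, [H_n, A]]` are eventually constant in `n`, so the quadratic Taylor
bound holds in the limit and yields the derivative. -/
theorem generatorAt_limit (hH : ConvergentHamiltonians H) {A : quasiLocal d}
    (hA : (A : Op d) ∈ localObservables d) {B : Op d}
    (hB : ∀ᶠ n in atTop, comm (H n) A = B) : GeneratorAt hH.limitEquiv A B := by
  obtain ⟨B', hB'l, hB'⟩ := hH.derivation A hA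
  obtain rfl : B' = B := by
    obtain ⟨n, h1, h2⟩ := (hB.and hB').exists
    rw [← h1, ← h2]
  obtain ⟨D, -, hD⟩ := hH.derivation B' hB'l
  have key : ∀ t : ℝ, ‖(hH.limit t A : Op d) - A - t • (Complex.I • B')‖ ≤ ‖D‖ * t ^ 2 := by
    intro t
    refine le_of_tendsto (((hH.tendsto_limit t A).sub_const _).sub_const _).norm ?_
    filter_upwards [hB, hD] with n hn hn'
    rw [← hn', ← hn]
    exact norm_heisenberg_sub_linear_le (hH.isSelfAdjoint n) _ t
  rw [GeneratorAt, hasDerivAt_iff_isLittleO_nhds_zero]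
  refine Asymptotics.IsBigO.trans_isLittleO (g := fun t : ℝ => t ^ 2) ?_ ?_
  · refine Asymptotics.IsBigO.of_bound ‖D‖ (Eventually.of_forall fun t => ?_)
    rw [Real.norm_of_nonneg (sq_nonneg t), zero_add]
    have := key t
    rw [show (A : Op d) = hH.limit 0 A by rw [hH.limit_zero]] at this
    rw [hH.limit_zero] at this
    have h0 : hH.limitEquiv 0 A = A := hH.limit_zero A
    rw [h0]
    exact this
  · exact Asymptotics.isLittleO_pow_id one_lt_two

end ConvergentHamiltonians

theorem isThermodynamicLimit_limitEquiv {Φ : Interaction d}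
    (hH : ConvergentHamiltonians fun n => Φ.hamiltonian (box n)) :
    IsThermodynamicLimit Φ hH.limitEquiv where
  map_zero := hH.limit_zero
  map_add := hH.limit_add_time
  continuous := hH.continuous_limit
  tendsto := hH.tendsto_limit
  generator A hA := by
    obtain ⟨B, -, hB⟩ := hH.derivation A hA
    exact ⟨B, tendsto_const_nhds.congr' (hB.mono fun _ h => h.symm), hH.generatorAt_limit hA hB⟩

/-! ### Finite group averages as conditional expectations, and approximation by local observables -/

section Average

variable {A B G : Type*} [Ring A] [Algebra ℂ A] [Ring B] [Algebra ℂ B] [Group G] [Fintype G]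

/-- The average of `ρ g * T * ρ g⁻¹` over a finite group. -/
def groupAverage (ρ : G →* A) (T : A) : A :=
  (Fintype.card G : ℂ)⁻¹ • ∑ g, ρ g * T * ρ g⁻¹

theorem groupAverage_add (ρ : G →* A) (S T : A) :
    groupAverage ρ (S + T) = groupAverage ρ S + groupAverage ρ T := by
  simp only [groupAverage, mul_add, add_mul, Finset.sum_add_distrib, smul_add]

theorem groupAverage_smul (ρ : G →* A) (c : ℂ) (S : A) :
    groupAverage ρ (c • S) = c • groupAverage ρ S := by
  simp only [groupAverage, mul_smul_comm, smul_mul_assoc, ← Finset.smul_sum, smul_comm c]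

theorem groupAverage_sub (ρ : G →* A) (S T : A) :
    groupAverage ρ (S - T) = groupAverage ρ S - groupAverage ρ T := by
  simp only [groupAverage, mul_sub, sub_mul, Finset.sum_sub_distrib, smul_sub]

theorem groupAverage_mul_of_commute (ρ : G →* A) {S : A} (h : ∀ g, Commute (ρ g) S) (T : A) :
    groupAverage ρ (S * T) = S * groupAverage ρ T := by
  simp only [groupAverage, mul_smul_comm, Finset.mul_sum]
  congr 1
  refine Finset.sum_congr rfl fun g _ => ?_
  rw [← mul_assoc, (h g).eq, mul_assoc, mul_assoc, mul_assoc]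

theorem conj_groupAverage (ρ : G →* A) (h : G) (T : A) :
    ρ h * groupAverage ρ T * ρ h⁻¹ = groupAverage ρ T := by
  simp only [groupAverage, mul_smul_comm, smul_mul_assoc, Finset.mul_sum, Finset.sum_mul]
  congr 1
  refine Fintype.sum_equiv (Equiv.mulLeft h) _ _ fun g => ?_
  simp only [Equiv.coe_mulLeft, mul_inv_rev, map_mul, mul_assoc]

theorem map_groupAverage (ρ : G →* A) (f : A →ₐ[ℂ] B) (T : A) :
    f (groupAverage ρ T) = groupAverage ((f : A →* B).comp ρ) (f T) := by
  simp [groupAverage]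

end Average

section Norm

variable {G : Type*} [Group G] [Fintype G]

theorem norm_le_one_of_mem_unitary {U : Op d} (hU : U ∈ unitary (Op d)) : ‖U‖ ≤ 1 := by
  rw [← mul_one U, CStarRing.norm_mem_unitary_mul _ hU]
  exact ContinuousLinearMap.norm_id_le

theorem norm_groupAverage_le {ρ : G →* Op d} (hρ : ∀ g, ρ g ∈ unitary (Op d)) {T : Op d} {c : ℝ}
    (hT : ‖T‖ ≤ c) : ‖groupAverage ρ T‖ ≤ c := by
  rw [groupAverage, norm_smul, norm_inv, Complex.norm_natCast]
  have h1 : ‖∑ g, ρ g * T * ρ g⁻¹‖ ≤ Fintype.card G * c := by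
    refine (norm_sum_le_of_le _ (f := fun g => ρ g * T * ρ g⁻¹) (n := fun _ => c)
      fun g _ => ?_).trans (by simp)
    rwa [CStarRing.norm_mul_mem_unitary _ (hρ _), CStarRing.norm_mem_unitary_mul _ (hρ _)]
  have h2 : (0 : ℝ) < Fintype.card G := by exact_mod_cast Fintype.card_pos
  rwa [inv_mul_le_iff₀ h2]

/-- Each summand differs from `T` by `-[T, ρ g] ρ g⁻¹`, whose norm is that of the commutator. -/
theorem norm_groupAverage_sub_le {ρ : G →* Op d} (hρ : ∀ g, ρ g ∈ unitary (Op d)) {T : Op d}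
    {c : ℝ} (hT : ∀ g, ‖comm T (ρ g)‖ ≤ c) : ‖groupAverage ρ T - T‖ ≤ c := by
  have h2 : (0 : ℝ) < Fintype.card G := by exact_mod_cast Fintype.card_pos
  have h3 : (Fintype.card G : ℂ) ≠ 0 := by exact_mod_cast h2.ne'
  have : groupAverage ρ T - T = (Fintype.card G : ℂ)⁻¹ • ∑ g, (-comm T (ρ g)) * ρ g⁻¹ := by
    have h : ∀ g, (-comm T (ρ g)) * ρ g⁻¹ = ρ g * T * ρ g⁻¹ - T := by
      intro g
      rw [comm, neg_sub, sub_mul, mul_assoc T, ← map_mul, mul_inv_cancel, map_one, mul_one]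
    simp only [h, Finset.sum_sub_distrib, smul_sub, groupAverage]
    congr 1
    rw [Finset.sum_const, Finset.card_univ, ← Nat.cast_smul_eq_nsmul ℂ, smul_smul,
      inv_mul_cancel₀ h3, one_smul]
  rw [this, norm_smul, norm_inv, Complex.norm_natCast, inv_mul_le_iff₀ h2]
  refine (norm_sum_le_of_le _ (f := fun g => (-comm T (ρ g)) * ρ g⁻¹) (n := fun _ => c)
    fun g _ => ?_).trans (by simp)
  rw [CStarRing.norm_mul_mem_unitary _ (hρ _), norm_neg]
  exact hT g

end Norm

section Matrix

variable {ι : Type*} [Fintype ι] [DecidableEq ι]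

/-- Diagonal sign matrices. -/
def signHom (ι : Type*) [Fintype ι] [DecidableEq ι] : (ι → ℤˣ) →* Matrix ι ι ℂ where
  toFun s := Matrix.diagonal fun i => ((s i : ℤ) : ℂ)
  map_one' := by simp
  map_mul' s t := by simp [Matrix.diagonal_mul_diagonal]

/-- Permutation matrices. -/
def permHom (ι : Type*) [Fintype ι] [DecidableEq ι] : Equiv.Perm ι →* Matrix ι ι ℂ where
  -- `permMatrix` reverses products; the inverse makes the map multiplicative.
  toFun σ := (σ⁻¹).permMatrix ℂ
  map_one' := by simp
  map_mul' σ τ := by rw [mul_inv_rev, Matrix.permMatrix_mul]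

theorem signHom_mem_unitary (s : ι → ℤˣ) : signHom ι s ∈ unitary (Matrix ι ι ℂ) := by
  have h : star (signHom ι s) = signHom ι s := by
    simp [signHom, Matrix.star_eq_conjTranspose, Matrix.diagonal_conjTranspose]
  rw [Unitary.mem_iff, h, ← map_mul]
  have : s * s = 1 := by funext i; simp
  simp [this]

theorem permHom_mem_unitary (σ : Equiv.Perm ι) : permHom ι σ ∈ unitary (Matrix ι ι ℂ) := by
  have h : star (permHom ι σ) = permHom ι σ⁻¹ := by
    simp [permHom, Matrix.star_eq_conjTranspose, Matrix.conjTranspose_permMatrix]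
  rw [Unitary.mem_iff, h, ← map_mul, ← map_mul]
  simp

theorem permHom_conj_diagonal (σ : Equiv.Perm ι) (v : ι → ℂ) :
    permHom ι σ * Matrix.diagonal v * permHom ι σ⁻¹ = Matrix.diagonal (v ∘ ⇑σ⁻¹) := by
  have h : permHom ι σ * Matrix.diagonal v = Matrix.diagonal (v ∘ ⇑σ⁻¹) * permHom ι σ := by
    ext i j
    simp only [permHom, MonoidHom.coe_mk, OneHom.coe_mk, Matrix.mul_diagonal,
      Matrix.diagonal_mul, Function.comp, Equiv.Perm.permMatrix, PEquiv.toMatrix_apply,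
      Equiv.toPEquiv_apply, Option.mem_def, Option.some.injEq]
    by_cases hij : σ⁻¹ i = j
    · subst hij; simp
    · simp only [hij, if_false, mul_zero, zero_mul]
  rw [h, mul_assoc, ← map_mul, mul_inv_cancel, map_one, mul_one]

/-- Averaging over signed permutation matrices gives a scalar matrix. -/
theorem groupAverage_perm_sign (M : Matrix ι ι ℂ) :
    ∃ c : ℂ, groupAverage (permHom ι) (groupAverage (signHom ι) M) = c • 1 := by
  have h1 : ∃ v, groupAverage (signHom ι) M = Matrix.diagonal v := by
    refine ⟨_, ((Matrix.isDiag_iff_diagonal_diag _).1 fun i j hij => ?_).symm⟩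
    -- Flipping the sign of the single coordinate `i` negates the entry `(i, j)` for `j ≠ i`;
    -- invariance of the average forces it to vanish.
    have h := conj_groupAverage (signHom ι) (Function.update 1 i (-1)) M
    have h2 := congrFun (congrFun h i) j
    have h3 : (Function.update (1 : ι → ℤˣ) i (-1))⁻¹ = Function.update (1 : ι → ℤˣ) i (-1) := by
      funext k; simp
    rw [h3] at h2
    have h5 : ∀ (s t : ι → ℤˣ) (N : Matrix ι ι ℂ),
        (signHom ι s * N * signHom ι t) i j = (s i : ℤ) * N i j * (t j : ℤ) := by
      intro s t N
      simp [signHom, Matrix.mul_diagonal, Matrix.diagonal_mul]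
    rw [h5, Function.update_self, Function.update_of_ne hij.symm] at h2
    simpa [neg_eq_self] using h2
  obtain ⟨v, hv⟩ := h1
  have h2 : ∃ w, groupAverage (permHom ι) (groupAverage (signHom ι) M) = Matrix.diagonal w := by
    rw [hv, groupAverage]
    simp only [permHom_conj_diagonal]
    refine ⟨_, ((Matrix.isDiag_iff_diagonal_diag _).1 fun i j hij => ?_).symm⟩
    simp [Matrix.sum_apply, hij]
  obtain ⟨w, hw⟩ := h2
  -- Invariance under permutations, applied below to transpositions, makes the diagonal constant.
  have h3 : ∀ σ : Equiv.Perm ι, w ∘ ⇑σ⁻¹ = w := by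
    intro σ
    have h := conj_groupAverage (permHom ι) σ (groupAverage (signHom ι) M)
    rw [hw, permHom_conj_diagonal] at h
    exact Matrix.diagonal_injective h
  rw [hw]
  rcases isEmpty_or_nonempty ι with he | ⟨⟨i⟩⟩
  · exact ⟨0, Subsingleton.elim _ _⟩
  · refine ⟨w i, ?_⟩
    rw [Matrix.smul_one_eq_diagonal]
    congr 1
    funext j
    have := congrFun (h3 (Equiv.swap i j)) j
    simpa using this.symm

end Matrix

/-- Unitaries of `𝒜_X` given by a unitary matrix representation. -/
def unitaryHom {G : Type*} [Group G] (X : Finset ℤ)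
    (ρ : G →* Matrix (LocConf d X) (LocConf d X) ℂ) : G →* Op d :=
  ((locRep d X : Matrix (LocConf d X) (LocConf d X) ℂ →ₐ[ℂ] Op d) :
    Matrix (LocConf d X) (LocConf d X) ℂ →* Op d).comp ρ

theorem unitaryHom_apply {G : Type*} [Group G] (X : Finset ℤ)
    (ρ : G →* Matrix (LocConf d X) (LocConf d X) ℂ) (g : G) :
    unitaryHom X ρ g = locRep d X (ρ g) := rfl

theorem unitaryHom_mem_unitary {G : Type*} [Group G] {X : Finset ℤ}
    {ρ : G →* Matrix (LocConf d X) (LocConf d X) ℂ} (hρ : ∀ g, ρ g ∈ unitary _) (g : G) :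
    unitaryHom X ρ g ∈ unitary (Op d) := by
  have h := Unitary.mem_iff.1 (hρ g)
  rw [unitaryHom_apply, Unitary.mem_iff, ← map_star, ← map_mul, ← map_mul, h.1, h.2, map_one]
  exact ⟨rfl, rfl⟩

/-- The average over the signed permutation matrices on the subsystem `X`. -/
def expectation (X : Finset ℤ) (T : Op d) : Op d :=
  groupAverage (unitaryHom X (permHom (LocConf d X)))
    (groupAverage (unitaryHom X (signHom (LocConf d X))) T)

/-- On a product `S * T` with `S` on `W` and `T` on `X`, the averaging unitaries commute with `S`
and reduce `T` to a scalar. The finite group of signed permutations thus does the work of a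
normalized partial trace. -/
theorem expectation_mem {W X : Finset ℤ} (hWX : Disjoint W X) {T : Op d}
    (hT : T ∈ localAlgebra d (W ∪ X)) : expectation X T ∈ localAlgebra d W := by
  refine localAlgebra_union_induction (p := fun T => expectation X T ∈ localAlgebra d W) hWX
    ?_ ?_ ?_ ?_ hT
  · intro S T hS hT
    simp only [expectation, groupAverage_add] at *
    exact add_mem hS hT
  · intro c S hS
    simp only [expectation, groupAverage_smul] at *
    exact SMulMemClass.smul_mem _ hS
  · simp [expectation, groupAverage]
  · intro S hS T hT
    have hc : ∀ M, Commute (locRep d X M) S := fun M =>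
      (commute_of_disjoint hWX hS (locRep_mem X M)).symm
    obtain ⟨M, rfl⟩ := mem_localAlgebra_iff.1 hT
    have hs : ∀ g, Commute (unitaryHom X (signHom (LocConf d X)) g) S := fun g => hc (signHom _ g)
    have hp : ∀ g, Commute (unitaryHom X (permHom (LocConf d X)) g) S := fun g => hc (permHom _ g)
    rw [expectation, groupAverage_mul_of_commute _ hs, groupAverage_mul_of_commute _ hp]
    clear hs hp hc
    have h := map_groupAverage (signHom (LocConf d X))
      (locRep d X : Matrix (LocConf d X) (LocConf d X) ℂ →ₐ[ℂ] Op d) M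
    have h' := map_groupAverage (permHom (LocConf d X))
      (locRep d X : Matrix (LocConf d X) (LocConf d X) ℂ →ₐ[ℂ] Op d)
      (groupAverage (signHom (LocConf d X)) M)
    obtain ⟨c, hc⟩ := groupAverage_perm_sign M
    rw [h, hc, map_smul, map_one] at h'
    have h2 : groupAverage (unitaryHom X (permHom (LocConf d X)))
        (groupAverage (unitaryHom X (signHom (LocConf d X))) (locRep d X M)) = c • 1 := h'.symm
    rw [h2]
    exact mul_mem hS (SMulMemClass.smul_mem _ (one_mem _))

theorem norm_expectation_le (X : Finset ℤ) (T : Op d) : ‖expectation X T‖ ≤ ‖T‖ :=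
  norm_groupAverage_le (unitaryHom_mem_unitary permHom_mem_unitary)
    (norm_groupAverage_le (unitaryHom_mem_unitary signHom_mem_unitary) le_rfl)

/-- The factor 2 counts the two successive averages: each moves `T` by at most `c`, and the second
does not enlarge the error of the first. -/
theorem norm_expectation_sub_le {X : Finset ℤ} {T : Op d} {c : ℝ} (hc : 0 ≤ c)
    (h : ∀ B ∈ localAlgebra d X, ‖comm T B‖ ≤ c * ‖B‖) : ‖expectation X T - T‖ ≤ 2 * c := by
  have hb : ∀ U ∈ localAlgebra d X, U ∈ unitary (Op d) → ‖comm T U‖ ≤ c := fun U hU hu =>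
    (h U hU).trans (mul_le_of_le_one_right hc (norm_le_one_of_mem_unitary hu))
  have h1 := norm_groupAverage_sub_le (ρ := unitaryHom X (signHom (LocConf d X)))
    (unitaryHom_mem_unitary signHom_mem_unitary) (T := T) (c := c)
    (fun g => hb _ (locRep_mem _ _) (unitaryHom_mem_unitary signHom_mem_unitary g))
  have h2 := norm_groupAverage_sub_le (ρ := unitaryHom X (permHom (LocConf d X)))
    (unitaryHom_mem_unitary permHom_mem_unitary) (T := T) (c := c)
    (fun g => hb _ (locRep_mem _ _) (unitaryHom_mem_unitary permHom_mem_unitary g))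
  have h3 := norm_groupAverage_le (ρ := unitaryHom X (permHom (LocConf d X)))
    (unitaryHom_mem_unitary permHom_mem_unitary) h1
  rw [groupAverage_sub] at h3
  have h4 := norm_add_le_of_le h3 h2
  rw [sub_add_sub_cancel] at h4
  rw [expectation]
  linarith

/-- An observable which almost commutes with everything outside of a box is almost localized in
the box. -/
theorem exists_local_approx {T : Op d} (hT : T ∈ quasiLocal d) {m : ℕ} {c : ℝ} (hc : 0 ≤ c)
    (h : ∀ X : Finset ℤ, Disjoint (box m) X → ∀ B ∈ localAlgebra d X, ‖comm T B‖ ≤ c * ‖B‖)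
    {ε : ℝ} (hε : 0 < ε) : ∃ S ∈ localAlgebra d (box m), ‖T - S‖ ≤ 2 * c + ε := by
  -- The expectation lands in the box algebra only for a local input, so it is applied to a local
  -- approximant `T₀`. The commutator bound concerns `T`, and contractivity of the expectation
  -- transfers it at the cost `ε`.
  rw [mem_regionAlgebra_iff, Metric.mem_closure_iff] at hT
  obtain ⟨T₀, ⟨Z, -, hZ⟩, hd⟩ := hT ε hε
  have hdis : Disjoint (box m) (Z \ box m) := Finset.disjoint_sdiff
  refine ⟨expectation (Z \ box m) T₀, expectation_mem hdis (localAlgebra_mono ?_ hZ), ?_⟩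
  · rw [Finset.union_sdiff_self_eq_union]
    exact Finset.subset_union_right
  · have h1 := norm_expectation_sub_le hc (h _ hdis)
    have h2 := norm_expectation_le (Z \ box m) (T - T₀)
    rw [dist_eq_norm] at hd
    have h3 : expectation (Z \ box m) (T - T₀)
        = expectation (Z \ box m) T - expectation (Z \ box m) T₀ := by
      simp only [expectation, groupAverage_sub]
    rw [h3] at h2
    rw [← norm_sub_rev] at h1
    have h4 := norm_add_le_of_le h1 h2
    rw [sub_add_sub_cancel] at h4
    linarith

/-- Up to `ε / 4` the family lies in a bounded part of a finite-dimensional algebra, which is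
covered by finitely many balls of radius `ε / 2`. -/
theorem totallyBounded_of_local_approx {ι : Type*} {T : ι → Op d} {c : ℝ} (hc : ∀ i, ‖T i‖ ≤ c)
    (h : ∀ ε > 0, ∃ m, ∀ i, ∃ S ∈ localAlgebra d (box m), ‖T i - S‖ ≤ ε) :
    TotallyBounded (Set.range T) := by
  rw [Metric.totallyBounded_iff]
  intro ε hε
  obtain ⟨m, hm⟩ := h (ε / 4) (by positivity)
  have := properSpace_localAlgebra (d := d) (box m)
  have hK : TotallyBounded ((Subtype.val : localAlgebra d (box m) → Op d) ''
      Metric.closedBall 0 (c + ε / 4)) :=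
    ((isCompact_closedBall _ _).image continuous_subtype_val).totallyBounded
  obtain ⟨t, ht, hcov⟩ := Metric.totallyBounded_iff.1 hK (ε / 2) (by positivity)
  refine ⟨t, ht, ?_⟩
  rintro _ ⟨i, rfl⟩
  obtain ⟨S, hS, hd⟩ := hm i
  have hSn : ‖S‖ ≤ c + ε / 4 := by
    have := norm_sub_norm_le S (T i)
    rw [norm_sub_rev] at this
    linarith [hc i]
  have := hcov ⟨⟨S, hS⟩, by simpa using hSn, rfl⟩
  simp only [Set.mem_iUnion, Metric.mem_ball] at this ⊢
  obtain ⟨y, hy, hyd⟩ := this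
  refine ⟨y, hy, ?_⟩
  have h1 := dist_triangle (T i) S y
  rw [dist_eq_norm (T i) S] at h1
  linarith

/-! ### Mean ergodic theorem for totally bounded orbits -/

section MeanErgodic

variable {E : Type*} [NormedAddCommGroup E] [NormedSpace ℝ E] [CompleteSpace E]

/-- A mean ergodic theorem: for a strongly continuous group of isometries, the time averages along
a totally bounded orbit converge to an invariant vector. -/
theorem exists_tendsto_average {U : ℝ → E →L[ℝ] E} (hadd : ∀ s t x, U (s + t) x = U s (U t x))
    (hnorm : ∀ t x, ‖U t x‖ = ‖x‖) (hcont : ∀ x, Continuous fun t => U t x) {x : E}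
    (hx : TotallyBounded (Set.range fun t => U t x)) :
    ∃ y, Tendsto (fun n : ℕ => (n : ℝ)⁻¹ • ∫ t in (0 : ℝ)..n, U t x) atTop (𝓝 y) ∧
      ∀ t, U t y = y := by
  have hi : ∀ a b, IntervalIntegrable (fun t => U t x) volume a b := fun a b =>
    (hcont x).intervalIntegrable a b
  have hshift : ∀ s b : ℝ, U s (∫ t in (0 : ℝ)..b, U t x) = ∫ t in s..(s + b), U t x := by
    intro s b
    rw [← (U s).intervalIntegral_comp_comm (hi _ _)]
    simp only [← hadd]
    rw [intervalIntegral.integral_comp_add_left (fun t => U t x), add_zero]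
  set A : ℕ → E := fun n => (n : ℝ)⁻¹ • ∫ t in (0 : ℝ)..n, U t x with hA
  have hK : IsCompact (closure (convexHull ℝ (Set.range fun t => U t x))) :=
    (hx.convexHull.closure).isCompact_of_isClosed isClosed_closure
  -- The index is shifted because an average over an interval of length zero is not a convex
  -- combination.
  have hmem : ∀ n, A (n + 1) ∈ closure (convexHull ℝ (Set.range fun t => U t x)) := by
    intro n
    have h := (convex_convexHull ℝ (Set.range fun t => U t x)).closure.set_average_mem
      (μ := volume) (t := Set.uIoc (0 : ℝ) (n + 1 : ℕ)) (f := fun t => U t x)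
      isClosed_closure ?_ ?_ (Eventually.of_forall fun t =>
        subset_closure (subset_convexHull ℝ _ ⟨t, rfl⟩)) (hi _ _).def'
    · rw [interval_average_eq, sub_zero] at h
      exact h
    · rw [Set.uIoc_of_le (by positivity), Real.volume_Ioc]
      simp
      positivity
    · rw [Set.uIoc_of_le (by positivity), Real.volume_Ioc]
      exact ENNReal.ofReal_ne_top
  obtain ⟨y, -, φ, hφ, hy⟩ := hK.tendsto_subseq hmem
  have hinv : ∀ s, U s y = y := by
    intro s
    have h1 : Tendsto (fun n => U s (A (φ n + 1)) - A (φ n + 1)) atTop (𝓝 (U s y - y)) :=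
      (((U s).continuous.tendsto y).comp hy).sub hy
    have h2 : Tendsto (fun n => U s (A (φ n + 1)) - A (φ n + 1)) atTop (𝓝 0) := by
      -- Translating the interval `[0, n]` by `s` changes the integral only near its two ends, which
      -- contribute at most `‖x‖ * |s|` each.
      have hb : ∀ n : ℕ, ‖U s (A n) - A n‖ ≤ (n : ℝ)⁻¹ * (2 * (‖x‖ * |s|)) := by
        intro n
        have e : U s (A n) - A n
            = (n : ℝ)⁻¹ • ((∫ t in (n : ℝ)..(n + s), U t x) - ∫ t in (0 : ℝ)..s, U t x) := by
          simp only [hA, map_smul, hshift]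
          rw [← smul_sub, add_comm (n : ℝ) s, intervalIntegral.integral_interval_sub_interval_comm
            (hi _ _) (hi _ _) (hi _ _)]
          congr 1
          rw [intervalIntegral.integral_symm (n : ℝ) (s + n), intervalIntegral.integral_symm 0 s]
          abel
        rw [e, norm_smul, norm_inv, Real.norm_natCast]
        gcongr
        have h3 := intervalIntegral.norm_integral_le_of_norm_le_const (a := (n : ℝ)) (b := n + s)
          (f := fun t => U t x) (C := ‖x‖) (fun t _ => (hnorm t x).le)
        have h4 := intervalIntegral.norm_integral_le_of_norm_le_const (a := (0 : ℝ)) (b := s)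
          (f := fun t => U t x) (C := ‖x‖) (fun t _ => (hnorm t x).le)
        rw [add_sub_cancel_left] at h3
        rw [sub_zero] at h4
        refine (norm_sub_le _ _).trans ?_
        linarith
      have h0 : Tendsto (fun n : ℕ => ((n : ℝ))⁻¹ * (2 * (‖x‖ * |s|))) atTop (𝓝 0) := by
        simpa using tendsto_inv_atTop_nhds_zero_nat.mul_const (2 * (‖x‖ * |s|))
      exact (squeeze_zero_norm hb h0).comp ((tendsto_add_atTop_nat 1).comp hφ.tendsto_atTop)
    exact sub_eq_zero.1 (tendsto_nhds_unique h1 h2)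
  -- From a subsequence to the whole sequence: since `y` is invariant, `‖D n‖` is subadditive, so
  -- `‖D n‖ / n` converges by Fekete's lemma, and the subsequence identifies its limit as zero.
  set D : ℕ → E := fun n => (∫ t in (0 : ℝ)..n, U t x) - (n : ℝ) • y with hD
  have hsub : Subadditive fun n => ‖D n‖ := by
    intro m n
    have e : D (m + n) = D m + U m (D n) := by
      simp only [hD, map_sub, map_smul, hinv, hshift]
      rw [Nat.cast_add, ← intervalIntegral.integral_add_adjacent_intervals (hi 0 m) (hi m (m + n)),
        add_smul]
      abel
    simp only [e]
    exact (norm_add_le _ _).trans (by rw [hnorm])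
  have hquot : ∀ n : ℕ, n ≠ 0 → ‖D n‖ / n = ‖A n - y‖ := by
    intro n hn
    have hn' : (n : ℝ) ≠ 0 := by exact_mod_cast hn
    have : A n - y = (n : ℝ)⁻¹ • D n := by
      simp only [hA, hD, smul_sub, smul_smul, inv_mul_cancel₀ hn', one_smul]
    rw [this, norm_smul, norm_inv, Real.norm_natCast, div_eq_inv_mul]
  have hlim := hsub.tendsto_lim ⟨0, by rintro _ ⟨n, rfl⟩; positivity⟩
  have hzero : hsub.lim = 0 := by
    have h1 := hlim.comp ((tendsto_add_atTop_nat 1).comp hφ.tendsto_atTop)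
    have h2 : Tendsto (fun n => ‖A (φ n + 1) - y‖) atTop (𝓝 0) := by
      simpa using (hy.sub_const y).norm
    refine tendsto_nhds_unique h1 (h2.congr fun n => ?_)
    exact (hquot (φ n + 1) (by omega)).symm
  rw [hzero] at hlim
  refine ⟨y, ?_, hinv⟩
  rw [tendsto_iff_norm_sub_tendsto_zero]
  refine hlim.congr' ?_
  filter_upwards [eventually_ne_atTop 0] with n hn using hquot n hn

end MeanErgodic

/-! ### Measurability, and the transport coefficient at `β = 0` -/

variable {Ω : Type*} [MeasurableSpace Ω]

theorem patch_injective (X : Finset ℤ) (σ : Conf d) : Function.Injective (patch X σ) := by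
  intro i j h
  rw [← restr_patch X σ i, h, restr_patch]

theorem ActsAs.entry {X : Finset ℤ} {M : Matrix (LocConf d X) (LocConf d X) ℂ} {T : Op d}
    (h : ActsAs X M T) (σ : Conf d) (j i : LocConf d X) :
    M j i = ⟪ket (patch X σ j), T (ket (patch X σ i))⟫_ℂ := by
  classical
  rw [h, restr_patch, inner_sum]
  simp only [patch_patch, inner_smul_right, inner_ket_ket, (patch_injective X σ).eq_iff]
  simp

/-- A local observable is a finite combination of matrix units whose coefficients are weak matrix
elements. A reference configuration outside `X` is needed to write them; it exists because no site
has dimension zero. -/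
theorem stronglyMeasurable_of_weak (hd : ∀ x, 1 ≤ d x) {X : Finset ℤ} {T : Ω → Op d}
    (hT : ∀ ω, T ω ∈ localAlgebra d X) (hm : ∀ φ ψ : Hil d, Measurable fun ω => ⟪φ, T ω ψ⟫_ℂ) :
    StronglyMeasurable T := by
  let σ : Conf d := fun x => ⟨0, hd x⟩
  have e : T = fun ω => ∑ j : LocConf d X, ∑ i : LocConf d X,
      ⟪ket (patch X σ j), T ω (ket (patch X σ i))⟫_ℂ • matUnit j i := by
    funext ω
    obtain ⟨M, hM⟩ := mem_localAlgebra_iff.1 (hT ω)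
    have h : ActsAs X M (T ω) := hM ▸ actsAs_locRep X M
    simp only [← h.entry σ]
    rw [← hM, locRep_eq_sum]
  rw [e]
  exact Finset.stronglyMeasurable_fun_sum _ fun j _ => Finset.stronglyMeasurable_fun_sum _ fun i _ =>
    (hm _ _).stronglyMeasurable.smul_const _

/-- By continuity the supremum may be taken over a countable dense set. -/
theorem measurable_iSup_of_continuous {α : Type*} [TopologicalSpace α]
    [TopologicalSpace.SeparableSpace α] {f : Ω → α → ℝ≥0∞} (hc : ∀ ω, Continuous (f ω))
    (hm : ∀ a, Measurable fun ω => f ω a) : Measurable fun ω => ⨆ a, f ω a := by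
  obtain ⟨s, hs, hd⟩ := TopologicalSpace.exists_countable_dense α
  have e : (fun ω => ⨆ a, f ω a) = fun ω => ⨆ a : s, f ω a := by
    funext ω
    refine le_antisymm (iSup_le fun a => ?_) (iSup_le fun a => le_iSup (f ω) a)
    have hcl : IsClosed {a | f ω a ≤ ⨆ a : s, f ω a} := isClosed_le (hc ω) continuous_const
    exact closure_minimal (fun b hb => le_iSup (fun a : s => f ω a) ⟨b, hb⟩) hcl (hd a)
  have := hs.to_subtype
  rw [e]
  exact Measurable.iSup fun a => hm a

/-- The unit ball of `𝒜_X`. -/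
abbrev UnitBall (d : ℤ → ℕ) (X : Finset ℤ) : Type := {A : Op d // A ∈ localAlgebra d X ∧ ‖A‖ ≤ 1}

theorem separableSpace_unitBall (X : Finset ℤ) :
    TopologicalSpace.SeparableSpace (UnitBall d X) := by
  have h : TopologicalSpace.IsSeparable {A : Op d | A ∈ localAlgebra d X ∧ ‖A‖ ≤ 1} :=
    (isSeparable_localAlgebra (d := d) X).mono fun _ h => h.1
  exact h.separableSpace

theorem continuous_heisenberg_comp {α : Type*} [TopologicalSpace α] {f h : α → Op d} {g : α → ℝ}
    (hf : Continuous f) (hg : Continuous g) (hh : Continuous h) :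
    Continuous fun a => heisenberg (f a) (g a) (h a) := by
  have := continuous_heisenberg.comp (hf.prodMk (hg.prodMk hh))
  simpa only [Function.comp_def] using this

theorem continuous_comm_comp {α : Type*} [TopologicalSpace α] {f g : α → Op d}
    (hf : Continuous f) (hg : Continuous g) : Continuous fun a => comm (f a) (g a) :=
  continuous_comm.comp (hf.prodMk hg)

/-- The denominator is `c * 2` at every time, including `t = 0`, as `0 ^ 0 = 1`. Merging the suprema
into one over a separable space gives measurability. -/
theorem transport_eq (H : Op d) (c : ℝ) (X Y : Finset ℤ) : transport H c 0 X Y =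
    ⨆ p : ℝ × UnitBall d X × UnitBall d Y,
      ENNReal.ofReal (‖comm (heisenberg H p.1 p.2.1) p.2.2‖ / (c * 2)) := by
  have h2 : (1 + 1 : ℝ) = 2 := by norm_num
  simp only [transport, Real.rpow_zero, h2, iSup_prod, iSup_subtype]

theorem measurable_transport {H : Ω → Op d} (hH : StronglyMeasurable H) (c : ℝ) (X Y : Finset ℤ) :
    Measurable fun ω => transport (H ω) c 0 X Y := by
  have := separableSpace_unitBall (d := d) X
  have := separableSpace_unitBall (d := d) Y
  simp only [transport_eq]
  refine measurable_iSup_of_continuous (fun ω => ?_) fun p => ?_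
  · refine ENNReal.continuous_ofReal.comp ((Continuous.norm ?_).div_const _)
    exact continuous_comm_comp (continuous_heisenberg_comp continuous_const continuous_fst
      (continuous_subtype_val.comp (continuous_fst.comp continuous_snd)))
      (continuous_subtype_val.comp (continuous_snd.comp continuous_snd))
  · have h : Continuous fun H : Op d => comm (heisenberg H p.1 p.2.1) p.2.2 :=
      continuous_comm_comp (continuous_heisenberg_comp continuous_id continuous_const
        continuous_const) continuous_const
    have h' : StronglyMeasurable fun ω => comm (heisenberg (H ω) p.1 p.2.1) p.2.2 :=
      h.comp_stronglyMeasurable hH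
    exact (h'.norm.measurable.div_const _).ennreal_ofReal

theorem ofReal_norm_comm_le_transport {H : Op d} {c : ℝ} (hc : 0 < c) {X Y : Finset ℤ} (t : ℝ)
    {A B : Op d} (hA : A ∈ localAlgebra d X) (hB : B ∈ localAlgebra d Y) :
    ENNReal.ofReal ‖comm (heisenberg H t A) B‖ ≤
      ENNReal.ofReal (2 * c * ‖A‖ * ‖B‖) * transport H c 0 X Y := by
  have hzero : ∀ A B : Op d, ‖A‖ * ‖B‖ = 0 → comm (heisenberg H t A) B = 0 := by
    intro A B h
    rcases mul_eq_zero.1 h with h | h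
    · rw [norm_eq_zero.1 h]; simp [heisenberg_eq, comm]
    · rw [norm_eq_zero.1 h]; simp [comm]
  -- The normalization to unit vectors below divides by both norms.
  by_cases h0 : ‖A‖ * ‖B‖ = 0
  · rw [hzero A B h0]; simp
  have hA0 : ‖A‖ ≠ 0 := left_ne_zero_of_mul h0
  have hB0 : ‖B‖ ≠ 0 := right_ne_zero_of_mul h0
  have hA1 : ((‖A‖ : ℂ)⁻¹ • A) ∈ localAlgebra d X ∧ ‖(‖A‖ : ℂ)⁻¹ • A‖ ≤ 1 :=
    ⟨SMulMemClass.smul_mem _ hA, by rw [norm_smul]; simp [hA0]⟩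
  have hB1 : ((‖B‖ : ℂ)⁻¹ • B) ∈ localAlgebra d Y ∧ ‖(‖B‖ : ℂ)⁻¹ • B‖ ≤ 1 :=
    ⟨SMulMemClass.smul_mem _ hB, by rw [norm_smul]; simp [hB0]⟩
  have h := le_iSup (fun p : ℝ × UnitBall d X × UnitBall d Y =>
      ENNReal.ofReal (‖comm (heisenberg H p.1 p.2.1) p.2.2‖ / (c * 2))) (t, ⟨_, hA1⟩, ⟨_, hB1⟩)
  rw [← transport_eq] at h
  have e : ‖comm (heisenberg H t A) B‖ = 2 * c * ‖A‖ * ‖B‖ *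
      (‖comm (heisenberg H t ((‖A‖ : ℂ)⁻¹ • A)) ((‖B‖ : ℂ)⁻¹ • B)‖ / (c * 2)) := by
    have : comm (heisenberg H t ((‖A‖ : ℂ)⁻¹ • A)) ((‖B‖ : ℂ)⁻¹ • B)
        = ((‖A‖ : ℂ)⁻¹ * (‖B‖ : ℂ)⁻¹) • comm (heisenberg H t A) B := by
      simp only [comm, heisenberg_smul, smul_mul_assoc, mul_smul_comm, smul_smul, smul_sub]
      rw [mul_comm (‖B‖ : ℂ)⁻¹]
    rw [this, norm_smul]
    simp only [norm_mul, norm_inv, Complex.norm_real, norm_norm]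
    field_simp
  rw [e, ENNReal.ofReal_mul (by positivity)]
  gcongr

theorem stronglyMeasurable_integral_heisenberg {H A : Ω → Op d} (hH : StronglyMeasurable H)
    (hA : StronglyMeasurable A) (b : ℝ) :
    StronglyMeasurable fun ω => ∫ t in (0 : ℝ)..b, heisenberg (H ω) t (A ω) := by
  have h1 : StronglyMeasurable fun p : Ω × ℝ => (H p.1, p.2, A p.1) :=
    (hH.comp_measurable measurable_fst).prodMk
      (measurable_snd.stronglyMeasurable.prodMk (hA.comp_measurable measurable_fst))
  have h : StronglyMeasurable fun p : Ω × ℝ => heisenberg (H p.1) p.2 (A p.1) :=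
    by simpa only [Function.comp_def] using continuous_heisenberg.comp_stronglyMeasurable h1
  simp only [intervalIntegral]
  exact h.integral_prod_right.sub h.integral_prod_right

/-! ### Geometry of finite-range interactions -/

namespace Interaction

variable {φ : Interaction d} {R : ℕ} {J : ℝ}

theorem sum_mem_localAlgebra {S : Finset (Finset ℤ)} {Y : Finset ℤ}
    (h : ∀ X ∈ S, φ.toFun X ≠ 0 → X ⊆ Y) : ∑ X ∈ S, φ.toFun X ∈ localAlgebra d Y := by
  refine sum_mem fun X hX => ?_
  by_cases h0 : φ.toFun X = 0
  · rw [h0]; exact zero_mem _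
  · exact localAlgebra_mono (h X hX h0) (φ.mem_localAlgebra X)

theorem norm_sum_le_card (hJ : ∀ X, ‖φ.toFun X‖ ≤ J) {S T : Finset (Finset ℤ)}
    (h : ∀ X ∈ S, φ.toFun X ≠ 0 → X ∈ T) : ‖∑ X ∈ S, φ.toFun X‖ ≤ T.card * J := by
  have e : ∑ X ∈ S ∩ T, φ.toFun X = ∑ X ∈ S, φ.toFun X := by
    refine Finset.sum_subset Finset.inter_subset_left fun X hX hX' => ?_
    by_contra h0
    exact hX' (Finset.mem_inter.2 ⟨hX, h X hX h0⟩)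
  have h0 : 0 ≤ J := (norm_nonneg _).trans (hJ ∅)
  rw [← e]
  refine (norm_sum_le_of_le _ fun X _ => hJ X).trans ?_
  rw [Finset.sum_const, nsmul_eq_mul]
  gcongr
  exact Finset.inter_subset_right

theorem hamiltonian_mem (φ : Interaction d) (Λ : Finset ℤ) :
    φ.hamiltonian Λ ∈ localAlgebra d Λ :=
  sum_mem_localAlgebra fun _ hX _ => Finset.mem_powerset.1 hX

theorem isSelfAdjoint_hamiltonian (φ : Interaction d) (Λ : Finset ℤ) :
    IsSelfAdjoint (φ.hamiltonian Λ) :=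
  isSelfAdjoint_sum _ fun X _ => φ.isSelfAdjoint X

theorem HasRange.abs_sub_le (hR : φ.HasRange R) {X : Finset ℤ} (h : φ.toFun X ≠ 0) {x y : ℤ}
    (hx : x ∈ X) (hy : y ∈ X) : |x - y| ≤ R := by
  by_contra h'
  exact h (hR X ⟨x, hx, y, hy, not_le.1 h'⟩)

theorem hamiltonian_succ_sub (φ : Interaction d) (n : ℕ) :
    φ.hamiltonian (box (n + 1)) - φ.hamiltonian (box n)
      = ∑ X ∈ (box (n + 1)).powerset \ (box n).powerset, φ.toFun X := by
  rw [hamiltonian, hamiltonian, sub_eq_iff_eq_add,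
    Finset.sum_sdiff (Finset.powerset_mono.2 (box_mono n.le_succ))]

theorem exists_boundary_site {n : ℕ} {X : Finset ℤ}
    (hX : X ∈ (box (n + 1)).powerset \ (box n).powerset) :
    X ⊆ box (n + 1) ∧ ((n : ℤ) + 1 ∈ X ∨ -(n : ℤ) - 1 ∈ X) := by
  rw [Finset.mem_sdiff, Finset.mem_powerset, Finset.mem_powerset] at hX
  refine ⟨hX.1, ?_⟩
  obtain ⟨x, hx, hx'⟩ := Finset.not_subset.1 hX.2
  have h1 := hX.1 hx
  simp only [box, Finset.mem_Icc] at h1 hx'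
  have : x = n + 1 ∨ x = -n - 1 := by push_cast at h1; omega
  rcases this with rfl | rfl
  · exact Or.inl hx
  · exact Or.inr hx

/-- Every new term contains one of the sites `±(n + 1)`, and a set of diameter at most `R` cannot
reach from there into `box m`. -/
theorem hamiltonian_succ_sub_mem (hR : φ.HasRange R) {n m : ℕ} (hn : m + R ≤ n) :
    φ.hamiltonian (box (n + 1)) - φ.hamiltonian (box n)
      ∈ localAlgebra d (box (n + 1) \ box m) := by
  rw [hamiltonian_succ_sub]
  refine sum_mem_localAlgebra fun X hX h0 x hx => ?_
  obtain ⟨hX1, hX2⟩ := exists_boundary_site hX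
  refine Finset.mem_sdiff.2 ⟨hX1 hx, fun hxm => ?_⟩
  simp only [box, Finset.mem_Icc] at hxm
  rcases hX2 with h | h
  · have := hR.abs_sub_le h0 h hx
    rw [abs_le] at this
    omega
  · have := hR.abs_sub_le h0 h hx
    rw [abs_le] at this
    omega

/-- The nonzero new terms live in one of two end windows of `R + 1` sites, each with `2 ^ (R + 1)`
subsets. -/
theorem norm_hamiltonian_succ_sub_le (hR : φ.HasRange R) (hJ : ∀ X, ‖φ.toFun X‖ ≤ J) (n : ℕ) :
    ‖φ.hamiltonian (box (n + 1)) - φ.hamiltonian (box n)‖ ≤ 2 * 2 ^ (R + 1) * J := by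
  have h0 : 0 ≤ J := (norm_nonneg _).trans (hJ ∅)
  rw [hamiltonian_succ_sub]
  refine (norm_sum_le_card hJ (T := (Finset.Icc ((n : ℤ) + 1 - R) (n + 1)).powerset ∪
    (Finset.Icc (-(n : ℤ) - 1) (-n - 1 + R)).powerset) fun X hX h0 => ?_).trans ?_
  · obtain ⟨hX1, hX2⟩ := exists_boundary_site hX
    rw [Finset.mem_union, Finset.mem_powerset, Finset.mem_powerset]
    refine hX2.imp (fun h x hx => ?_) (fun h x hx => ?_)
    all_goals
      have h1 := hR.abs_sub_le h0 h hx
      have h2 := hX1 hx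
      rw [abs_le] at h1
      simp only [box, Finset.mem_Icc] at h2 ⊢
      push_cast at h2
      omega
  · gcongr
    have h1 : (Finset.Icc ((n : ℤ) + 1 - R) (n + 1)).card = R + 1 := by
      rw [Int.card_Icc]; omega
    have h2 : (Finset.Icc (-(n : ℤ) - 1) (-n - 1 + R)).card = R + 1 := by
      rw [Int.card_Icc]; omega
    have h3 := Finset.card_union_le (Finset.Icc ((n : ℤ) + 1 - R) (n + 1)).powerset
      (Finset.Icc (-(n : ℤ) - 1) (-n - 1 + R)).powerset
    rw [Finset.card_powerset, Finset.card_powerset, h1, h2, ← two_mul] at h3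
    exact_mod_cast h3

theorem comm_hamiltonian_eq (hR : φ.HasRange R) {k n : ℕ} (hn : k + R ≤ n) {A : Op d}
    (hA : A ∈ localAlgebra d (box k)) :
    comm (φ.hamiltonian (box n)) A = comm (φ.hamiltonian (box (k + R))) A := by
  induction n, hn using Nat.le_induction with
  | base => rfl
  | succ n hn ih =>
    rw [← ih, ← sub_eq_zero]
    have h := comm_eq_zero_of_disjoint (Finset.sdiff_disjoint)
      (hamiltonian_succ_sub_mem hR hn) hA
    rw [← h]
    simp only [comm, sub_mul, mul_sub]
    abel

theorem exists_comm_hamiltonian_eq (hR : φ.HasRange R) {A : Op d} (hA : A ∈ localObservables d) :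
    ∃ B ∈ localObservables d, ∀ᶠ n in atTop, comm (φ.hamiltonian (box n)) A = B := by
  obtain ⟨X, hX⟩ := hA
  obtain ⟨k, hk⟩ := subset_box X
  refine ⟨comm (φ.hamiltonian (box (k + R))) A, ⟨box (k + R), ?_⟩, ?_⟩
  · have h1 := φ.hamiltonian_mem (box (k + R))
    have h2 := localAlgebra_mono (hk.trans (box_mono (Nat.le_add_right k R))) hX
    exact sub_mem (mul_mem h1 h2) (mul_mem h2 h1)
  · filter_upwards [eventually_ge_atTop (k + R)] with n hn
    exact comm_hamiltonian_eq hR hn (localAlgebra_mono hk hX)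

theorem coe_energy (φ : Interaction d) (R : ℕ) (x : ℤ) : (φ.energy R x : Op d) =
    ∑ X ∈ (Finset.Icc x (x + R)).powerset with x ∈ X, φ.toFun X := by
  rw [energy, AddSubmonoidClass.coe_finsetSum]

theorem energy_mem (φ : Interaction d) (R : ℕ) (x : ℤ) :
    (φ.energy R x : Op d) ∈ localAlgebra d (Finset.Icc x (x + R)) := by
  rw [coe_energy]
  exact sum_mem_localAlgebra fun X hX _ => Finset.mem_powerset.1 (Finset.mem_filter.1 hX).1

theorem isSelfAdjoint_energy (φ : Interaction d) (R : ℕ) (x : ℤ) :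
    IsSelfAdjoint (φ.energy R x : Op d) := by
  rw [coe_energy]
  exact isSelfAdjoint_sum _ fun X _ => φ.isSelfAdjoint X

theorem norm_energy_le (hJ : ∀ X, ‖φ.toFun X‖ ≤ J) (R : ℕ) (x : ℤ) :
    ‖(φ.energy R x : Op d)‖ ≤ 2 ^ (R + 1) * J := by
  rw [coe_energy]
  refine (norm_sum_le_card hJ (T := (Finset.Icc x (x + R)).powerset)
    fun X hX _ => (Finset.mem_filter.1 hX).1).trans (le_of_eq ?_)
  have : (Finset.Icc x (x + R)).card = R + 1 := by rw [Int.card_Icc]; omega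
  rw [Finset.card_powerset, this]
  push_cast
  rfl

/-- The Hamiltonian of a box is the sum of the energy terms, up to a boundary term. -/
theorem exists_hamiltonian_eq_sum_energy (hR : φ.HasRange R) (hJ : ∀ X, ‖φ.toFun X‖ ≤ J) (n : ℕ) :
    ∃ W ∈ localAlgebra d (Finset.Icc ((n : ℤ) - R) n), ‖W‖ ≤ 2 ^ (R + 1) * J ∧
      φ.hamiltonian (box n) = φ.toFun ∅ +
        ∑ x ∈ Finset.Icc (-(n : ℤ)) (n - R), (φ.energy R x : Op d) + W := by
  set S : Finset (Finset ℤ) := (Finset.Icc (-(n : ℤ)) (n - R)).biUnion fun x =>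
    {X ∈ (Finset.Icc x (x + R)).powerset | x ∈ X} with hS
  have hsum : ∑ x ∈ Finset.Icc (-(n : ℤ)) (n - R), (φ.energy R x : Op d) = ∑ X ∈ S, φ.toFun X := by
    rw [hS, Finset.sum_biUnion]
    · exact Finset.sum_congr rfl fun x _ => φ.coe_energy R x
    · intro x _ y _ hxy
      rw [Function.onFun, Finset.disjoint_left]
      intro X hX hX'
      simp only [Finset.mem_filter, Finset.mem_powerset] at hX hX'
      have h1 := hX.1 hX'.2
      have h2 := hX'.1 hX.2
      rw [Finset.mem_Icc] at h1 h2
      omega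
  -- The empty set has no leftmost site and belongs to no energy term, so it is split off.
  have hempty : ∅ ∉ S := by simp [hS]
  have hsub : insert ∅ S ⊆ (box n).powerset := by
    intro X hX
    rw [Finset.mem_powerset]
    rcases Finset.mem_insert.1 hX with rfl | hX
    · exact Finset.empty_subset _
    · simp only [hS, Finset.mem_biUnion, Finset.mem_filter, Finset.mem_powerset] at hX
      obtain ⟨x, hx, hX, -⟩ := hX
      refine hX.trans fun y hy => ?_
      simp only [box, Finset.mem_Icc] at hx hy ⊢
      omega
  -- A nonzero term on a nonempty set with minimum at most `n - R` is already counted in the energy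
  -- at its minimum; the others lie in the last `R + 1` sites.
  have hrest : ∀ X ∈ (box n).powerset \ insert ∅ S, φ.toFun X ≠ 0 →
      X ⊆ Finset.Icc ((n : ℤ) - R) n := by
    intro X hX h0 y hy
    rw [Finset.mem_sdiff, Finset.mem_powerset, Finset.mem_insert, not_or] at hX
    obtain ⟨hX1, hX2, hX3⟩ := hX
    have hne : X.Nonempty := Finset.nonempty_iff_ne_empty.2 hX2
    have hm := X.min'_mem hne
    have hlt : (n : ℤ) - R < X.min' hne := by
      by_contra hle
      refine hX3 (Finset.mem_biUnion.2 ⟨X.min' hne, ?_, ?_⟩)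
      · have := hX1 hm
        simp only [box, Finset.mem_Icc] at this ⊢
        omega
      · rw [Finset.mem_filter, Finset.mem_powerset]
        refine ⟨fun z hz => ?_, hm⟩
        have h1 := X.min'_le z hz
        have h2 := hR.abs_sub_le h0 hz hm
        rw [abs_le] at h2
        rw [Finset.mem_Icc]
        omega
    have h1 := X.min'_le y hy
    have h2 := hX1 hy
    simp only [box, Finset.mem_Icc] at h2 ⊢
    omega
  refine ⟨∑ X ∈ (box n).powerset \ insert ∅ S, φ.toFun X, sum_mem_localAlgebra hrest, ?_, ?_⟩
  · refine (norm_sum_le_card hJ (T := (Finset.Icc ((n : ℤ) - R) n).powerset)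
      fun X hX h0 => Finset.mem_powerset.2 (hrest X hX h0)).trans (le_of_eq ?_)
    have : (Finset.Icc ((n : ℤ) - R) n).card = R + 1 := by rw [Int.card_Icc]; omega
    rw [Finset.card_powerset, this]
    push_cast
    rfl
  · rw [hsum, ← Finset.sum_insert hempty, add_comm, Finset.sum_sdiff hsub, hamiltonian]

end Interaction

/-! ### Deterministic consequences of localization for a typical realization -/

/-- The transport from the box `[-k, k]` to the subsystem `Y` under the dynamics of `[-n, n]`. -/
def boxTransport (φ : Interaction d) (χ : ℕ → ℝ) (k n : ℕ) (Y : Finset ℤ) : ℝ≥0∞ :=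
  transport (φ.hamiltonian (box n)) (χ (box k).card) 0 (box k) Y

/-- The total transport from the box `[-k, k]` to the energy terms which start outside of
`[-m, m]`. -/
def tailTransport (φ : Interaction d) (χ : ℕ → ℝ) (R k m n : ℕ) : ℝ≥0∞ :=
  boxTransport φ χ k n (Finset.Icc ((n : ℤ) - R) n) +
    ∑ x ∈ Finset.Icc (-(n : ℤ)) (n - R) \ box m, boxTransport φ χ k n (Finset.Icc x (x + R))

/-- The properties of a typical realization of a dynamically localized interaction. -/
structure Localized (φ : Interaction d) (χ : ℕ → ℝ) (R : ℕ) (J : ℝ) : Prop where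
  pos : ∀ n, 0 < χ n
  range : φ.HasRange R
  bound : ∀ X, ‖φ.toFun X‖ ≤ J
  summable : ∀ k, ∑' n : ℕ,
    boxTransport φ χ k (n + (k + R) + 1) (box (n + (k + R) + 1) \ box (n + k)) ≠ ∞
  confined : ∀ k, ∀ ε : ℝ≥0∞, ε ≠ 0 →
    ∃ m, liminf (fun n => boxTransport φ χ k n (box n \ box m)) atTop < ε
  tail : ∀ k, ∀ ε : ℝ≥0∞, ε ≠ 0 →
    ∃ m, k + R ≤ m ∧ liminf (fun n => tailTransport φ χ R k m n) atTop < ε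

theorem enorm_comm_heisenberg_le {H : Op d} {c : ℝ} (hc : 0 < c) {X Y : Finset ℤ} (t : ℝ)
    {A B : Op d} (hA : A ∈ localAlgebra d X) (hB : B ∈ localAlgebra d Y) {b : ℝ} (hb : ‖B‖ ≤ b) :
    ‖comm (heisenberg H t A) B‖ₑ ≤ ENNReal.ofReal (2 * c * ‖A‖ * b) * transport H c 0 X Y := by
  rw [← ofReal_norm]
  refine (ofReal_norm_comm_le_transport hc t hA hB).trans ?_
  gcongr

theorem enorm_comm_heisenberg_le' {H : Op d} (hH : IsSelfAdjoint H) {c : ℝ} (hc : 0 < c)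
    {X Y : Finset ℤ} (t : ℝ) {A B : Op d} (hA : A ∈ localAlgebra d X)
    (hB : B ∈ localAlgebra d Y) {b : ℝ} (hb : ‖B‖ ≤ b) :
    ‖comm (heisenberg H t B) A‖ₑ ≤ ENNReal.ofReal (2 * c * ‖A‖ * b) * transport H c 0 X Y := by
  rw [← ofReal_norm, norm_comm_heisenberg hH, ofReal_norm]
  exact enorm_comm_heisenberg_le hc _ hA hB hb

theorem isClosed_localAlgebra (X : Finset ℤ) : IsClosed (localAlgebra d X : Set (Op d)) := by
  have := finiteDimensional_localAlgebra (d := d) X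
  exact Submodule.closed_of_finiteDimensional
    (Subalgebra.toSubmodule (localAlgebra d X).toSubalgebra)

/-- Since `u` converges, a bound holding for infinitely many `n` already bounds the limit. This is
why lower limits of the transport, the quantities Fatou's lemma controls, are sufficient. -/
theorem le_of_tendsto_of_liminf_lt {u : ℕ → ℝ} {v : ℕ → ℝ≥0∞} {a c ε : ℝ} (hc : 0 ≤ c)
    (hε : 0 < ε) (hu : Tendsto u atTop (𝓝 a)) (hv : liminf v atTop < ENNReal.ofReal ε)
    (h : ∀ᶠ n in atTop, ENNReal.ofReal (u n) ≤ ENNReal.ofReal c * v n) : a ≤ c * ε := by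
  refine le_of_tendsto_of_frequently hu ?_
  refine ((frequently_lt_of_liminf_lt (by isBoundedDefault) hv).and_eventually h).mono fun n hn => ?_
  have h1 : ENNReal.ofReal (u n) ≤ ENNReal.ofReal (c * ε) := by
    rw [ENNReal.ofReal_mul hc]
    exact hn.2.trans (by gcongr; exact hn.1.le)
  exact (ENNReal.ofReal_le_ofReal_iff (by positivity)).1 h1

namespace Localized

variable {φ : Interaction d} {χ : ℕ → ℝ} {R : ℕ} {J : ℝ}

theorem nonneg (h : Localized φ χ R J) : 0 ≤ J := (norm_nonneg _).trans (h.bound ∅)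

theorem convergentHamiltonians (h : Localized φ χ R J) :
    ConvergentHamiltonians fun n => φ.hamiltonian (box n) where
  isSelfAdjoint n := φ.isSelfAdjoint_hamiltonian _
  mem n := localAlgebra_le_quasiLocal _ (φ.hamiltonian_mem _)
  derivation A hA := Interaction.exists_comm_hamiltonian_eq h.range hA
  summable k := by
    set T : ℕ → ℝ≥0∞ := fun n =>
      boxTransport φ χ k (n + (k + R) + 1) (box (n + (k + R) + 1) \ box (n + k)) with hT
    set c : ℝ := 2 * χ (box k).card * (2 * 2 ^ (R + 1) * J) with hc
    have hTs : Summable fun n => (T n).toReal := ENNReal.summable_toReal (h.summable k)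
    have hχ := h.pos (box k).card
    have hJ := h.nonneg
    refine ⟨fun n => c * (T (n - (k + R))).toReal, ?_, ?_⟩
    · refine Summable.mul_left _ ((summable_nat_add_iff (k + R)).1 ?_)
      simpa using hTs
    · filter_upwards [eventually_ge_atTop (k + R)] with n hn s A hA
      obtain ⟨j, rfl⟩ := Nat.exists_eq_add_of_le' hn
      -- The increment at volume `j + (k + R)` is supported outside `box (j + k)`, so the `j`-th
      -- transport term dominates the commutator in Duhamel's estimate.
      have h1 := enorm_comm_heisenberg_le (H := φ.hamiltonian (box (j + (k + R) + 1))) hχ s hA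
        (Interaction.hamiltonian_succ_sub_mem (m := j + k) h.range (by omega))
        (Interaction.norm_hamiltonian_succ_sub_le h.range h.bound (j + (k + R)))
      have h2 : T j ≠ ∞ := ENNReal.ne_top_of_tsum_ne_top (h.summable k) j
      have h3 := ENNReal.toReal_mono (ENNReal.mul_ne_top ENNReal.ofReal_ne_top h2) h1
      rw [toReal_enorm, ENNReal.toReal_mul, ENNReal.toReal_ofReal (by positivity)] at h3
      refine h3.trans (le_of_eq ?_)
      rw [Nat.add_sub_cancel, hc]
      ring

theorem exists_isThermodynamicLimit (h : Localized φ χ R J) :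
    ∃ τ, IsThermodynamicLimit φ τ :=
  ⟨_, isThermodynamicLimit_limitEquiv h.convergentHamiltonians⟩

/-- `H` is invariant under its own dynamics, so `[H, A]` expands into commutators with evolved
energy terms at any time `t`. What remains outside `box m`, together with the boundary term, is
transport out of `box k` and is bounded independently of `t`. -/
theorem enorm_comm_sub_sum_le (h : Localized φ χ R J) {k m n : ℕ} (hkm : k + R ≤ m)
    (hmn : m + R ≤ n) {A : Op d} (hA : A ∈ localAlgebra d (box k)) (t : ℝ) :
    ‖comm (φ.hamiltonian (box n)) A -
      ∑ x ∈ box m, comm (heisenberg (φ.hamiltonian (box n)) t (φ.energy R x)) A‖ₑ ≤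
    ENNReal.ofReal (2 * χ (box k).card * ‖A‖ * (2 ^ (R + 1) * J)) * tailTransport φ χ R k m n := by
  obtain ⟨W, hW, hWn, hH⟩ := Interaction.exists_hamiltonian_eq_sum_energy h.range h.bound n
  set H := φ.hamiltonian (box n) with hHdef
  have hsa : IsSelfAdjoint H := φ.isSelfAdjoint_hamiltonian _
  have hsub : box m ⊆ Finset.Icc (-(n : ℤ)) (n - R) := by
    intro x hx
    simp only [box, Finset.mem_Icc] at hx ⊢
    omega
  -- `Φ(∅)` acts on no site, hence commutes with `A` evolved backwards.
  have hempty : comm (heisenberg H t (φ.toFun ∅)) A = 0 := by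
    rw [← norm_eq_zero, norm_comm_heisenberg hsa, norm_eq_zero]
    refine comm_eq_zero_of_disjoint (Finset.disjoint_empty_right _)
      (heisenberg_mem (isClosed_localAlgebra (box n)) (φ.hamiltonian_mem _) ?_ _)
      (φ.mem_localAlgebra ∅)
    exact localAlgebra_mono (box_mono (by omega)) hA
  have hcadd : ∀ S T : Op d, comm (S + T) A = comm S A + comm T A := by
    intro S T; simp only [comm, add_mul, mul_add]; abel
  have hcsum : comm (∑ x ∈ Finset.Icc (-(n : ℤ)) (n - R), heisenberg H t (φ.energy R x)) A
      = ∑ x ∈ Finset.Icc (-(n : ℤ)) (n - R), comm (heisenberg H t (φ.energy R x)) A := by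
    simp only [comm, Finset.sum_mul, Finset.mul_sum, Finset.sum_sub_distrib]
  have e : comm H A - ∑ x ∈ box m, comm (heisenberg H t (φ.energy R x)) A =
      comm (heisenberg H t W) A + ∑ x ∈ Finset.Icc (-(n : ℤ)) (n - R) \ box m,
        comm (heisenberg H t (φ.energy R x)) A := by
    have h1 : comm H A = comm (heisenberg H t (φ.toFun ∅ +
        ∑ x ∈ Finset.Icc (-(n : ℤ)) (n - R), (φ.energy R x : Op d) + W)) A := by
      rw [← hH, heisenberg_self]
    rw [h1, heisenberg_add, heisenberg_add, heisenberg_sum, hcadd, hcadd, hcsum, hempty,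
      ← Finset.sum_sdiff hsub]
    abel
  rw [e, tailTransport, mul_add, Finset.mul_sum]
  refine (enorm_add_le (E := Op d) _ _).trans (add_le_add ?_ ((enorm_sum_le (ε := Op d) _ _).trans
    (Finset.sum_le_sum fun x _ => ?_)))
  · exact enorm_comm_heisenberg_le' hsa (h.pos _) t hA hW hWn
  · exact enorm_comm_heisenberg_le' hsa (h.pos _) t hA (φ.energy_mem R x)
      (Interaction.norm_energy_le h.bound R x)

end Localized

theorem tailTransport_anti (φ : Interaction d) (χ : ℕ → ℝ) (R k : ℕ) {m m' : ℕ} (h : m ≤ m')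
    (n : ℕ) : tailTransport φ χ R k m' n ≤ tailTransport φ χ R k m n := by
  unfold tailTransport
  gcongr
  exact box_mono h

namespace IsThermodynamicLimit

variable {φ : Interaction d} {χ : ℕ → ℝ} {R : ℕ} {J : ℝ}
  {τ : ℝ → quasiLocal d ≃⋆ₐ[ℂ] quasiLocal d}

theorem norm_map (hτ : IsThermodynamicLimit φ τ) (t : ℝ) (A : quasiLocal d) : ‖τ t A‖ = ‖A‖ := by
  refine tendsto_nhds_unique (hτ.tendsto t A).norm ?_
  simp only [norm_heisenberg (φ.isSelfAdjoint_hamiltonian _)]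
  exact tendsto_const_nhds

theorem tendsto_comm (hτ : IsThermodynamicLimit φ τ) (t : ℝ) (A : quasiLocal d) (B : Op d) :
    Tendsto (fun n : ℕ => comm (heisenberg (φ.hamiltonian (box n)) t A) B) atTop
      (𝓝 (comm (τ t A : Op d) B)) :=
  ((hτ.tendsto t A).mul_const B).sub ((hτ.tendsto t A).const_mul B)

/-- The orbit of a local observable is totally bounded. -/
theorem totallyBounded_orbit (hτ : IsThermodynamicLimit φ τ) (h : Localized φ χ R J)
    {A : quasiLocal d} (hA : (A : Op d) ∈ localObservables d) :
    TotallyBounded (Set.range fun t => τ t A) := by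
  have hcoe : Isometry (Subtype.val : quasiLocal d → Op d) := isometry_subtype_coe
  rw [← totallyBounded_image_iff hcoe.isUniformInducing, ← Set.range_comp]
  obtain ⟨X, hX⟩ := hA
  obtain ⟨k, hk⟩ := subset_box X
  have hAk := localAlgebra_mono hk hX
  have hχ := h.pos (box k).card
  refine totallyBounded_of_local_approx (c := ‖A‖) (fun t => (hτ.norm_map t A).le) fun ε hε => ?_
  set c : ℝ := 2 * χ (box k).card * ‖A‖ with hc
  have hc0 : 0 ≤ c := by positivity
  -- Chosen so that `2 * (c * δ) + ε / 2 ≤ ε`; the `+ 1` covers `A = 0`.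
  set δ : ℝ := ε / (4 * (c + 1)) with hδ
  have hδ0 : 0 < δ := by positivity
  obtain ⟨m, hm⟩ := h.confined k (ENNReal.ofReal δ) (by simpa using hδ0)
  refine ⟨m, fun t => ?_⟩
  obtain ⟨S, hS, hSn⟩ := exists_local_approx (τ t A).2 (m := m) (c := c * δ) (by positivity)
    (fun X hX B hB => by
      refine (le_of_tendsto_of_liminf_lt (c := c * ‖B‖) (by positivity) hδ0
        (hτ.tendsto_comm t A B).norm hm ?_).trans (le_of_eq (by ring))
      obtain ⟨N, hN⟩ := subset_box X
      filter_upwards [eventually_ge_atTop N] with n hn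
      rw [ofReal_norm]
      refine enorm_comm_heisenberg_le hχ t hAk (localAlgebra_mono ?_ hB) le_rfl
      intro x hx
      exact Finset.mem_sdiff.2 ⟨box_mono hn (hN hx), Finset.disjoint_right.1 hX hx⟩)
    (ε := ε / 2) (by positivity)
  refine ⟨S, hS, hSn.trans ?_⟩
  have : c * δ ≤ ε / 4 := by
    rw [hδ, mul_div_assoc', div_le_div_iff₀ (by positivity) (by positivity)]
    nlinarith
  linarith

/-- The derivation acts on local observables through the evolved energy terms, uniformly in
time. -/
theorem norm_sub_sum_comm_le (hτ : IsThermodynamicLimit φ τ) (h : Localized φ χ R J) {A B : Op d}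
    (hA : A ∈ localObservables d)
    (hB : Tendsto (fun n : ℕ => comm (φ.hamiltonian (box n)) A) atTop (𝓝 B)) {ε : ℝ}
    (hε : 0 < ε) : ∃ m₀, ∀ m ≥ m₀, ∀ t : ℝ,
      ‖B - ∑ x ∈ box m, comm (τ t (φ.energy R x) : Op d) A‖ ≤ ε := by
  obtain ⟨X, hX⟩ := hA
  obtain ⟨k, hk⟩ := subset_box X
  have hAk := localAlgebra_mono hk hX
  have hχ := h.pos (box k).card
  have hJ := h.nonneg
  set c : ℝ := 2 * χ (box k).card * ‖A‖ * (2 ^ (R + 1) * J) with hc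
  have hc0 : 0 ≤ c := by positivity
  set δ : ℝ := ε / (c + 1) with hδ
  have hδ0 : 0 < δ := by positivity
  obtain ⟨m₀, hkm, hm₀⟩ := h.tail k (ENNReal.ofReal δ) (by simpa using hδ0)
  refine ⟨m₀, fun m hm t => ?_⟩
  have hlim : liminf (fun n => tailTransport φ χ R k m n) atTop < ENNReal.ofReal δ :=
    (liminf_le_liminf (Eventually.of_forall fun n => tailTransport_anti φ χ R k hm n)).trans_lt hm₀
  have := le_of_tendsto_of_liminf_lt (c := c) hc0 hδ0
    (hB.sub (tendsto_finsetSum (box m) fun x _ => hτ.tendsto_comm t (φ.energy R x) A)).norm hlim (by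
      filter_upwards [eventually_ge_atTop (m + R)] with n hn
      rw [ofReal_norm]
      exact h.enorm_comm_sub_sum_le (hkm.trans hm) hn hAk t)
  refine this.trans ?_
  rw [hδ, mul_div_assoc', div_le_iff₀ (by positivity)]
  nlinarith

end IsThermodynamicLimit

/-! ### Time averages: invariance, derivation, dynamics, leakage -/

/-- Bounds on affine functions of a family of curves pass to the time averages. -/
theorem norm_sub_sum_average_le {E F ι : Type*} [NormedAddCommGroup E] [NormedSpace ℝ E]
    [CompleteSpace E] [NormedAddCommGroup F] [NormedSpace ℝ F] [CompleteSpace F]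
    (s : Finset ι) {f : ι → ℝ → E} (hf : ∀ i, Continuous (f i)) {y : ι → E}
    (hy : ∀ i, Tendsto (fun n : ℕ => (n : ℝ)⁻¹ • ∫ t in (0 : ℝ)..n, f i t) atTop (𝓝 (y i)))
    (L : ι → E →L[ℝ] F) (b : F) {c : ℝ} (h : ∀ t, ‖b - ∑ i ∈ s, L i (f i t)‖ ≤ c) :
    ‖b - ∑ i ∈ s, L i (y i)‖ ≤ c := by
  refine le_of_tendsto (tendsto_const_nhds.sub
    (tendsto_finsetSum s fun i _ => ((L i).continuous.tendsto _).comp (hy i))).norm ?_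
  filter_upwards [eventually_gt_atTop 0] with n hn
  have hn' : (0 : ℝ) < n := by exact_mod_cast hn
  have hi : ∀ i, IntervalIntegrable (fun t => L i (f i t)) volume 0 n := fun i =>
    ((L i).continuous.comp (hf i)).intervalIntegrable _ _
  have e : b - ∑ i ∈ s, L i ((n : ℝ)⁻¹ • ∫ t in (0 : ℝ)..n, f i t)
      = (n : ℝ)⁻¹ • ∫ t in (0 : ℝ)..n, (b - ∑ i ∈ s, L i (f i t)) := by
    have hs : Continuous fun t => ∑ i ∈ s, L i (f i t) :=
      continuous_finsetSum s fun i _ => (L i).continuous.comp (hf i)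
    rw [intervalIntegral.integral_sub intervalIntegrable_const (hs.intervalIntegrable _ _), intervalIntegral.integral_finsetSum
        fun i _ => hi i, intervalIntegral.integral_const, sub_zero, smul_sub, smul_smul,
      inv_mul_cancel₀ hn'.ne', one_smul, Finset.smul_sum]
    congr 1
    refine Finset.sum_congr rfl fun i _ => ?_
    rw [map_smul, (L i).intervalIntegral_comp_comm ((hf i).intervalIntegrable _ _)]
  simp only [Function.comp_def]
  rw [e, norm_smul, norm_inv, Real.norm_natCast, inv_mul_le_iff₀ hn']
  refine (intervalIntegral.norm_integral_le_of_norm_le_const fun t _ => h t).trans (le_of_eq ?_)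
  rw [sub_zero, abs_of_pos hn', mul_comm]

/-- `T ↦ [T, A]` as a continuous linear map. -/
def commL (A : Op d) : Op d →L[ℝ] Op d :=
  (ContinuousLinearMap.mul ℝ (Op d)).flip A - ContinuousLinearMap.mul ℝ (Op d) A

theorem commL_apply (A T : Op d) : commL A T = comm T A := rfl

/-- The adjoint as a real linear map. -/
def adjointL (d : ℤ → ℕ) : Op d →L[ℝ] Op d :=
  LinearMap.mkContinuous
    { toFun := star
      map_add' := star_add
      map_smul' := fun c T => (star_smul (c : ℂ) T).trans (by
        rw [Complex.star_def, Complex.conj_ofReal]; rfl) } 1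
    fun T => by rw [one_mul]; exact (norm_star T).le

theorem adjointL_apply (T : Op d) : adjointL d T = star T := rfl

/-- `I` is the time average of `A` along integer times. -/
def IsTimeAverage (τ : ℝ → quasiLocal d ≃⋆ₐ[ℂ] quasiLocal d) (A : quasiLocal d) (I : Op d) : Prop :=
  Tendsto (fun n : ℕ => (n : ℝ)⁻¹ • ∫ t in (0 : ℝ)..n, (τ t A : Op d)) atTop (𝓝 I)

namespace IsThermodynamicLimit

variable {φ : Interaction d} {χ : ℕ → ℝ} {R : ℕ} {J : ℝ}
  {τ : ℝ → quasiLocal d ≃⋆ₐ[ℂ] quasiLocal d}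

theorem continuous_coe (hτ : IsThermodynamicLimit φ τ) (A : quasiLocal d) :
    Continuous fun t => (τ t A : Op d) :=
  continuous_subtype_val.comp (hτ.continuous A)

/-- `τ_t` as a continuous linear map. -/
def mapL (hτ : IsThermodynamicLimit φ τ) (t : ℝ) : quasiLocal d →L[ℝ] quasiLocal d :=
  LinearMap.mkContinuous
    { toFun := τ t
      map_add' := _root_.map_add (τ t)
      map_smul' := fun c A => map_smul (τ t) (c : ℂ) A } 1
    fun A => by rw [one_mul]; exact (hτ.norm_map t A).le

theorem mapL_apply (hτ : IsThermodynamicLimit φ τ) (t : ℝ) (A : quasiLocal d) :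
    hτ.mapL t A = τ t A := rfl

/-- The inclusion of the quasi-local observables. -/
def coeL (d : ℤ → ℕ) : quasiLocal d →L[ℝ] Op d :=
  LinearMap.mkContinuous
    { toFun := Subtype.val
      map_add' := fun _ _ => rfl
      map_smul' := fun _ _ => rfl } 1 fun A => by rw [one_mul]; exact le_rfl

theorem coeL_apply (A : quasiLocal d) : coeL d A = (A : Op d) := rfl

theorem exists_isTimeAverage (hτ : IsThermodynamicLimit φ τ) (h : Localized φ χ R J)
    {A : quasiLocal d} (hA : (A : Op d) ∈ localObservables d) :
    ∃ I : quasiLocal d, IsTimeAverage τ A I ∧ ∀ t, τ t I = I := by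
  have := completeSpace_quasiLocal (d := d)
  obtain ⟨I, hI, hinv⟩ := exists_tendsto_average (U := hτ.mapL) hτ.map_add hτ.norm_map
    hτ.continuous (hτ.totallyBounded_orbit h hA)
  refine ⟨I, ((continuous_subtype_val.tendsto I).comp hI).congr fun n => ?_, hinv⟩
  have e := (coeL d).intervalIntegral_comp_comm
    ((hτ.continuous A).intervalIntegrable (μ := volume) 0 n)
  simp only [coeL_apply] at e
  rw [e]
  rfl

/-- Uniqueness of the limit transfers invariance to any element known only to be the time average,
such as a measurable modification. -/
theorem map_isTimeAverage (hτ : IsThermodynamicLimit φ τ) (h : Localized φ χ R J)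
    {A I : quasiLocal d} (hA : (A : Op d) ∈ localObservables d) (hI : IsTimeAverage τ A I)
    (t : ℝ) : τ t I = I := by
  obtain ⟨I', hI', hinv⟩ := hτ.exists_isTimeAverage h hA
  obtain rfl : I' = I := Subtype.ext (tendsto_nhds_unique hI' hI)
  exact hinv t

/-- Norm bounds uniform in time pass to the average; with `c = 0` this also transfers linear
identities such as self-adjointness. -/
theorem norm_sub_map_average_le (hτ : IsThermodynamicLimit φ τ) {A : quasiLocal d} {I : Op d}
    (hI : IsTimeAverage τ A I) (L : Op d →L[ℝ] Op d) {c : ℝ} (h : ∀ t, ‖L (τ t A)‖ ≤ c) :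
    ‖L I‖ ≤ c := by
  have := norm_sub_sum_average_le (Finset.univ : Finset Unit) (f := fun _ t => (τ t A : Op d))
    (fun _ => hτ.continuous_coe A) (y := fun _ => I) (fun _ => hI) (fun _ => L) 0 (c := c)
    (fun t => by simpa using h t)
  simpa using this

theorem norm_average_le (hτ : IsThermodynamicLimit φ τ) {A : quasiLocal d} {I : Op d}
    (hI : IsTimeAverage τ A I) : ‖I‖ ≤ ‖A‖ :=
  hτ.norm_sub_map_average_le hI (ContinuousLinearMap.id ℝ _) fun t => (hτ.norm_map t A).le

theorem isSelfAdjoint_average (hτ : IsThermodynamicLimit φ τ) {A : quasiLocal d} {I : Op d}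
    (hI : IsTimeAverage τ A I) (hA : IsSelfAdjoint A) : IsSelfAdjoint I := by
  have h := hτ.norm_sub_map_average_le hI
    (adjointL d - ContinuousLinearMap.id ℝ (Op d)) (c := 0) fun t => by
      have h1 : IsSelfAdjoint (τ t A) := hA.map (τ t)
      have h2 : star (τ t A : Op d) = τ t A := congrArg Subtype.val h1.star_eq
      simp [adjointL_apply, h2]
  exact sub_eq_zero.1 (norm_eq_zero.1 (le_antisymm h (norm_nonneg _)))

variable {I : ℤ → quasiLocal d}

/-- The estimate for the evolved energy terms is uniform in `t` while `B` is fixed, so it survives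
averaging for each large box. -/
theorem tendsto_sum_comm_average (hτ : IsThermodynamicLimit φ τ) (h : Localized φ χ R J)
    (hI : ∀ x, IsTimeAverage τ (φ.energy R x) (I x)) {A B : Op d} (hA : A ∈ localObservables d)
    (hB : Tendsto (fun n : ℕ => comm (φ.hamiltonian (box n)) A) atTop (𝓝 B)) :
    Tendsto (fun n : ℕ => ∑ x ∈ box n, comm (I x : Op d) A) atTop (𝓝 B) := by
  rw [Metric.tendsto_atTop]
  intro ε hε
  obtain ⟨m₀, hm⟩ := hτ.norm_sub_sum_comm_le h hA hB (half_pos hε)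
  refine ⟨m₀, fun n hn => ?_⟩
  rw [dist_comm, dist_eq_norm]
  refine (norm_sub_sum_average_le (box n) (f := fun x t => (τ t (φ.energy R x) : Op d))
    (fun x => hτ.continuous_coe _) hI (fun _ => commL A) B (hm n hn)).trans_lt (half_lt_self hε)

/-- The group law and isometry of `τ s` carry the derivative from time zero to time `s`. -/
theorem hasDerivAt_map (hτ : IsThermodynamicLimit φ τ) {A B : quasiLocal d}
    (hAB : GeneratorAt τ A B) (s : ℝ) :
    HasDerivAt (fun s => (τ s A : Op d)) (Complex.I • (τ s B : Op d)) s := by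
  rw [GeneratorAt, hasDerivAt_iff_isLittleO_nhds_zero] at hAB
  rw [hasDerivAt_iff_isLittleO_nhds_zero]
  refine Asymptotics.IsLittleO.of_norm_left (hAB.norm_left.congr_left fun h => ?_)
  have e : τ (s + h) A - τ s A - h • (Complex.I • τ s B)
      = τ s (τ (0 + h) A - τ 0 A - h • (Complex.I • B)) := by
    have h1 : τ s (h • (Complex.I • B)) = h • (Complex.I • τ s B) := by
      rw [← hτ.mapL_apply, map_smul, hτ.mapL_apply, map_smul]
    rw [map_sub, map_sub, h1, zero_add, ← hτ.map_add, hτ.map_zero]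
  have := hτ.norm_map s (τ (0 + h) A - τ 0 A - h • (Complex.I • B))
  rw [← e] at this
  exact this.symm

/-- Duhamel is applied to the curve `s ↦ τ s T`. As every `I x` is invariant, its defect at time `s`
is `τ s` of `B - ∑ [I x, T]`, whose norm does not depend on `s`; thus no propagation bound for the
averaged Hamiltonian is needed. Density extends this from local `T`. -/
theorem tendsto_heisenberg_average (hτ : IsThermodynamicLimit φ τ) (h : Localized φ χ R J)
    (hI : ∀ x, IsTimeAverage τ (φ.energy R x) (I x)) (t : ℝ) (A : quasiLocal d) :
    Tendsto (fun n : ℕ => heisenberg (∑ x ∈ box n, (I x : Op d)) t A) atTop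
      (𝓝 (τ t A : Op d)) := by
  have hlocal : ∀ x, (φ.energy R x : Op d) ∈ localObservables d := fun x =>
    ⟨_, φ.energy_mem R x⟩
  have hsa : ∀ n : ℕ, IsSelfAdjoint (∑ x ∈ box n, (I x : Op d)) := fun n =>
    isSelfAdjoint_sum _ fun x _ => hτ.isSelfAdjoint_average (hI x)
      (Subtype.ext (φ.isSelfAdjoint_energy R x))
  have key : ∀ k, ∀ T ∈ localAlgebra d (box k), ∃ hT : T ∈ quasiLocal d,
      Tendsto (fun n : ℕ => heisenberg (∑ x ∈ box n, (I x : Op d)) t T) atTop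
        (𝓝 (τ t ⟨T, hT⟩ : Op d)) := by
    intro k T hTk
    have hT := localAlgebra_le_quasiLocal _ hTk
    refine ⟨hT, ?_⟩
    obtain ⟨B, hB, hgen⟩ := hτ.generator ⟨T, hT⟩ ⟨_, hTk⟩
    have hBq : B ∈ quasiLocal d := isClosed_quasiLocal.mem_of_tendsto hB
      (Eventually.of_forall fun n => by
        have h1 := localAlgebra_le_quasiLocal _ (φ.hamiltonian_mem (box n))
        exact sub_mem (mul_mem h1 hT) (mul_mem hT h1))
    have hsum := hτ.tendsto_sum_comm_average h hI ⟨_, hTk⟩ hB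
    rw [tendsto_iff_norm_sub_tendsto_zero] at hsum ⊢
    have hbound : ∀ n : ℕ, ‖heisenberg (∑ x ∈ box n, (I x : Op d)) t T - τ t ⟨T, hT⟩‖
        ≤ ‖∑ x ∈ box n, comm (I x : Op d) T - B‖ * |t| := by
      intro n
      have h1 := norm_sub_heisenberg_le (hsa n)
        (c := ‖∑ x ∈ box n, comm (I x : Op d) T - B‖)
        (fun s => hτ.hasDerivAt_map (B := ⟨B, hBq⟩) hgen s) (fun s => by
          have e : Complex.I • (τ s ⟨B, hBq⟩ : Op d) -
              Complex.I • comm (∑ x ∈ box n, (I x : Op d)) (τ s ⟨T, hT⟩)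
              = Complex.I • (τ s (⟨B, hBq⟩ - ∑ x ∈ box n,
                (I x * ⟨T, hT⟩ - ⟨T, hT⟩ * I x)) : Op d) := by
            rw [← smul_sub, map_sub, map_sum]
            simp only [map_sub, map_mul, hτ.map_isTimeAverage h (hlocal _) (hI _)]
            congr 1
            simp only [comm, Finset.sum_mul, Finset.mul_sum, Finset.sum_sub_distrib]
            push_cast
            rfl
          rw [e, norm_smul, Complex.norm_I, one_mul]
          refine (hτ.norm_map s _).le.trans (le_of_eq ?_)
          rw [norm_sub_rev]
          simp only [comm]
          change ‖((∑ x ∈ box n, (I x * ⟨T, hT⟩ - ⟨T, hT⟩ * I x) - ⟨B, hBq⟩ : quasiLocal d) :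
            Op d)‖ = _
          push_cast
          rfl) t
      rw [hτ.map_zero, norm_sub_rev] at h1
      exact h1
    exact squeeze_zero (fun n => norm_nonneg _) hbound (by simpa using hsum.mul_const |t|)
  have hfin : ∀ T ∈ quasiLocal d, ∃ hT : T ∈ quasiLocal d,
      Tendsto (fun n : ℕ => heisenberg (∑ x ∈ box n, (I x : Op d)) t T) atTop
        (𝓝 (τ t ⟨T, hT⟩ : Op d)) := by
    intro T hT
    refine quasiLocal_induction (p := fun T => ∃ hT : T ∈ quasiLocal d,
      Tendsto (fun n : ℕ => heisenberg (∑ x ∈ box n, (I x : Op d)) t T) atTop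
        (𝓝 (τ t ⟨T, hT⟩ : Op d))) ?_ key hT
    refine isClosed_of_closure_subset fun A hA => ?_
    have hA' : A ∈ quasiLocal d :=
      closure_minimal (fun B hB => hB.choose) isClosed_quasiLocal hA
    refine ⟨hA', ?_⟩
    rw [Metric.mem_closure_iff] at hA
    rw [Metric.tendsto_atTop]
    intro ε hε
    obtain ⟨B, ⟨hB, hBt⟩, hAB⟩ := hA (ε / 3) (by positivity)
    obtain ⟨N, hN⟩ := Metric.tendsto_atTop.1 hBt (ε / 3) (by positivity)
    refine ⟨N, fun n hn => ?_⟩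
    have h1 : dist (heisenberg (∑ x ∈ box n, (I x : Op d)) t A)
        (heisenberg (∑ x ∈ box n, (I x : Op d)) t B) < ε / 3 := by
      rwa [dist_eq_norm, ← heisenberg_sub, norm_heisenberg (hsa n), ← dist_eq_norm]
    have h2 : dist (τ t ⟨B, hB⟩ : Op d) (τ t ⟨A, hA'⟩ : Op d) < ε / 3 := by
      rw [dist_eq_norm] at hAB
      rw [dist_comm, dist_eq_norm, ← AddSubgroupClass.coe_sub, ← map_sub]
      exact (hτ.norm_map t _).trans_lt hAB
    have h3 := dist_triangle4 (heisenberg (∑ x ∈ box n, (I x : Op d)) t A)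
      (heisenberg (∑ x ∈ box n, (I x : Op d)) t B) (τ t ⟨B, hB⟩ : Op d) (τ t ⟨A, hA'⟩ : Op d)
    have h4 := hN n hn
    linarith
  exact (hfin A A.2).choose_spec

-- For `B` local in `Y`, the commutator at each time is a limit of finite-volume ones, hence bounded
-- by the lower limit uniformly in `t`. This passes to the time average, and by density to all of
-- `regionAlgebra d Y`.
open Classical in
theorem leakage_average_le (hτ : IsThermodynamicLimit φ τ) (h : Localized φ χ R J) {x : ℤ}
    {I : Op d} (hI : IsTimeAverage τ (φ.energy R x) I) (Y : Set ℤ) :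
    leakage I Y ≤ liminf (fun n : ℕ =>
      ENNReal.ofReal (2 * χ (Finset.Icc x (x + R)).card * (2 ^ (R + 1) * J)) *
      transport (φ.hamiltonian (box n)) (χ (Finset.Icc x (x + R)).card) 0 (Finset.Icc x (x + R))
        {y ∈ box n | y ∈ Y}) atTop := by
  set v : ℕ → ℝ≥0∞ := fun n =>
      ENNReal.ofReal (2 * χ (Finset.Icc x (x + R)).card * (2 ^ (R + 1) * J)) *
      transport (φ.hamiltonian (box n)) (χ (Finset.Icc x (x + R)).card) 0 (Finset.Icc x (x + R))
        {y ∈ box n | y ∈ Y} with hv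
  by_cases htop : liminf v atTop = ∞
  · rw [htop]; exact le_top
  set c := (liminf v atTop).toReal with hc
  have hc0 : 0 ≤ c := ENNReal.toReal_nonneg
  have hχ := h.pos (Finset.Icc x (x + R)).card
  have hJ := h.nonneg
  have hbound : ∀ B ∈ regionAlgebra d Y, ‖comm I B‖ ≤ c * ‖B‖ := by
    intro B hB
    refine norm_comm_le_of_mem_regionAlgebra (fun X hX B hB => ?_) hB
    rw [← commL_apply]
    refine hτ.norm_sub_map_average_le hI _ fun t => ?_
    rw [commL_apply]
    refine le_of_forall_pos_le_add fun ε hε => ?_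
    have hlt : liminf v atTop < ENNReal.ofReal (c + ε / (‖B‖ + 1)) := by
      rw [← ENNReal.ofReal_toReal htop]
      exact (ENNReal.ofReal_lt_ofReal_iff (by positivity)).2
        (lt_add_of_pos_right _ (by positivity))
    have h1 := le_of_tendsto_of_liminf_lt (norm_nonneg B) (by positivity)
      (hτ.tendsto_comm t (φ.energy R x) B).norm hlt (by
        obtain ⟨N, hN⟩ := subset_box X
        filter_upwards [eventually_ge_atTop N] with n hn
        have h2 := ofReal_norm_comm_le_transport (H := φ.hamiltonian (box n)) hχ t
          (φ.energy_mem R x) (localAlgebra_mono (Y := {y ∈ box n | y ∈ Y}) (fun y hy =>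
            Finset.mem_filter.2 ⟨box_mono hn (hN hy), hX hy⟩) hB)
        refine h2.trans ?_
        rw [hv]
        dsimp only
        rw [← mul_assoc, ← ENNReal.ofReal_mul (norm_nonneg B)]
        refine mul_le_mul' (ENNReal.ofReal_le_ofReal ?_) le_rfl
        have h3 := Interaction.norm_energy_le h.bound R x
        calc _ ≤ 2 * χ (Finset.Icc x (x + R)).card * (2 ^ (R + 1) * J) * ‖B‖ := by gcongr
          _ = _ := by ring)
    refine h1.trans ?_
    have h4 : ‖B‖ * (ε / (‖B‖ + 1)) ≤ ε := by
      rw [mul_div_assoc', div_le_iff₀ (by positivity)]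
      nlinarith
    linarith
  refine iSup₂_le fun B hB => ?_
  rw [← ENNReal.ofReal_toReal htop]
  exact ENNReal.ofReal_le_ofReal ((hbound B hB.1).trans (mul_le_of_le_one_right hc0 hB.2))

end IsThermodynamicLimit

/-! ### Probabilistic estimates: Fatou, almost sure localization, expected leakage -/

theorem le_siteDist {X Y : Set ℤ} (hX : X.Nonempty) (hY : Y.Nonempty) {r : ℕ}
    (h : ∀ x ∈ X, ∀ y ∈ Y, r ≤ (x - y).natAbs) : r ≤ siteDist X Y := by
  obtain ⟨x, hx⟩ := hX
  obtain ⟨y, hy⟩ := hY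
  refine le_csInf ⟨_, x, hx, y, hy, rfl⟩ ?_
  rintro _ ⟨x, hx, y, hy, rfl⟩
  exact h x hx y hy

theorem siteDist_le {X Y : Set ℤ} {x y : ℤ} (hx : x ∈ X) (hy : y ∈ Y) :
    siteDist X Y ≤ (x - y).natAbs := Nat.sInf_le ⟨x, hx, y, hy, rfl⟩

theorem siteDist_singleton_le {x : ℤ} {R : ℕ} {Y : Set ℤ} (hY : Y.Nonempty) :
    siteDist {x} Y ≤ siteDist (Set.Icc x (x + R)) Y + R := by
  obtain ⟨y, hy⟩ := hY
  have hne : {n : ℕ | ∃ z ∈ Set.Icc x (x + R), ∃ y ∈ Y, n = (z - y).natAbs}.Nonempty :=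
    ⟨_, x, ⟨le_rfl, by omega⟩, y, hy, rfl⟩
  obtain ⟨z, hz, y', hy', he⟩ := Nat.sInf_mem hne
  have h1 := siteDist_le (X := {x}) rfl hy'
  rw [siteDist, siteDist] at *
  rw [he]
  obtain ⟨hz1, hz2⟩ := hz
  omega

/-- The infimum over `m ≥ m₀` has expectation zero, hence vanishes almost surely; one null set
serves every `ε`. -/
theorem ae_exists_lt_of_lintegral_le {P : Measure Ω} {f : ℕ → Ω → ℝ≥0∞} {g : ℕ → ℝ≥0∞}
    (hf : ∀ m, Measurable (f m)) (hg : Tendsto g atTop (𝓝 0)) (m₀ : ℕ)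
    (h : ∀ m ≥ m₀, ∫⁻ ω, f m ω ∂P ≤ g m) :
    ∀ᵐ ω ∂P, ∀ ε : ℝ≥0∞, ε ≠ 0 → ∃ m, m₀ ≤ m ∧ f m ω < ε := by
  have h0 : ∫⁻ ω, ⨅ m, f (m + m₀) ω ∂P = 0 := by
    refine le_antisymm (ge_of_tendsto' ((tendsto_add_atTop_iff_nat m₀).2 hg) fun m => ?_) zero_le
    exact (lintegral_mono fun ω => iInf_le _ m).trans (h _ (by omega))
  rw [lintegral_eq_zero_iff (Measurable.iInf fun m => hf _)] at h0
  filter_upwards [h0] with ω hω ε hε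
  have : ⨅ m, f (m + m₀) ω < ε := by
    rw [hω]; exact pos_iff_ne_zero.2 hε
  obtain ⟨m, hm⟩ := iInf_lt_iff.1 this
  exact ⟨m + m₀, by omega, hm⟩

theorem lintegral_liminf_le_of_eventually_le {P : Measure Ω} {f : ℕ → Ω → ℝ≥0∞}
    (hf : ∀ n, Measurable (f n)) {g : ℕ → ℝ≥0∞} {a : ℝ≥0∞} (hg : Tendsto g atTop (𝓝 a))
    (h : ∀ᶠ n in atTop, ∫⁻ ω, f n ω ∂P ≤ g n) :
    ∫⁻ ω, liminf (fun n => f n ω) atTop ∂P ≤ a :=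
  (lintegral_liminf_le hf).trans ((liminf_le_liminf h).trans_eq hg.liminf_eq)

theorem IsDecayFunction.summable {F : ℕ → ℝ} (hFd : IsDecayFunction F)
    (hF : Summable fun n : ℕ => (n : ℝ) * F n) : Summable F := by
  rw [← summable_nat_add_iff 1] at hF ⊢
  refine Summable.of_nonneg_of_le (fun n => (hFd.pos _).le) (fun n => ?_) hF
  refine le_mul_of_one_le_left (hFd.pos _).le ?_
  push_cast
  linarith [n.cast_nonneg (α := ℝ)]

theorem IsDecayFunction.summable_sub {F : ℕ → ℝ} (hF : Summable F) (c : ℕ) :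
    Summable fun n => F (n - c) := by
  rw [← summable_nat_add_iff c]
  simpa using hF

theorem IsDecayFunction.tsum_int_ne_top {F : ℕ → ℝ} (hF : Summable F) (c : ℕ) :
    ∑' x : ℤ, ENNReal.ofReal (F (x.natAbs - c)) ≠ ∞ := by
  have h : Summable fun x : ℤ => F (x.natAbs - c) :=
    Summable.of_nat_of_neg (by simpa using summable_sub hF c) (by simpa using summable_sub hF c)
  exact h.tsum_ofReal_ne_top

theorem tendsto_box_atTop : Tendsto box atTop atTop :=
  tendsto_atTop_finset_of_monotone (fun _ _ h => box_mono h) fun x =>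
    ⟨x.natAbs, by rw [box, Finset.mem_Icc]; omega⟩

section Random

variable {P : Measure Ω} {Φ : Ω → Interaction d} {χ F : ℕ → ℝ} {R : ℕ} {J : ℝ}

theorem lintegral_transport_le (hFd : IsDecayFunction F)
    (hb : LocalizationBound P (fun Λ ω => (Φ ω).hamiltonian Λ) F 0 χ) {n : ℕ} {a b : ℤ}
    (hab : a ≤ b) {Y : Finset ℤ} (hX : Finset.Icc a b ⊆ box n) (hY : Y ⊆ box n)
    (hYne : Y.Nonempty) (hsep : ∀ y ∈ Y, y < a ∨ b < y) {r : ℕ}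
    (hr : ∀ x ∈ Finset.Icc a b, ∀ y ∈ Y, r ≤ (x - y).natAbs) :
    ∫⁻ ω, transport ((Φ ω).hamiltonian (box n)) (χ (Finset.Icc a b).card) 0 (Finset.Icc a b) Y ∂P ≤
      ENNReal.ofReal (F r) := by
  have hXne : (Finset.Icc a b).Nonempty := ⟨a, Finset.mem_Icc.2 ⟨le_rfl, hab⟩⟩
  refine (hb (-n) n (Finset.Icc a b) Y hX hY hXne hYne fun y hy => ?_).trans
    (ENNReal.ofReal_le_ofReal (hFd.antitone (le_siteDist (by exact_mod_cast hXne)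
      (by exact_mod_cast hYne) (by exact_mod_cast hr))))
  refine (hsep y hy).imp (fun h x hx => ?_) (fun h x hx => ?_) <;>
  · rw [Finset.mem_Icc] at hx
    omega

/-- The strict inequality `k < |y|` keeps `Y` outside the box even when `r = 0`. -/
theorem lintegral_boxTransport_le (hFd : IsDecayFunction F)
    (hb : LocalizationBound P (fun Λ ω => (Φ ω).hamiltonian Λ) F 0 χ) {k n : ℕ} {Y : Finset ℤ}
    (hY : Y ⊆ box n) (hYne : Y.Nonempty) {r : ℕ}
    (hr : ∀ y ∈ Y, k < y.natAbs ∧ k + r ≤ y.natAbs) :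
    ∫⁻ ω, boxTransport (Φ ω) χ k n Y ∂P ≤ ENNReal.ofReal (F r) := by
  refine lintegral_transport_le hFd hb (by omega) (fun x hx => ?_) hY hYne (fun y hy => ?_)
    fun x hx y hy => ?_
  · obtain ⟨y, hy⟩ := hYne
    have h1 := hr y hy
    have h2 := hY hy
    simp only [box, Finset.mem_Icc] at *
    omega
  · have h1 := hr y hy
    omega
  · have h1 := hr y hy
    rw [Finset.mem_Icc] at hx
    omega

theorem measurable_boxTransport (hH : ∀ Λ, StronglyMeasurable fun ω => (Φ ω).hamiltonian Λ)
    (k n : ℕ) (Y : Finset ℤ) : Measurable fun ω => boxTransport (Φ ω) χ k n Y :=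
  measurable_transport (hH _) _ _ _

theorem measurable_tailTransport (hH : ∀ Λ, StronglyMeasurable fun ω => (Φ ω).hamiltonian Λ)
    (k m n : ℕ) : Measurable fun ω => tailTransport (Φ ω) χ R k m n :=
  (measurable_boxTransport hH _ _ _).add
    (Finset.measurable_fun_sum _ fun _ _ => measurable_boxTransport hH _ _ _)

/-- The `n`-th shell starts at distance `n + 1` from `box k`, so the expected sum is at most `∑ F (n
+ 1)`. -/
theorem ae_summable_boxTransport (hFd : IsDecayFunction F) (hF : Summable F)
    (hb : LocalizationBound P (fun Λ ω => (Φ ω).hamiltonian Λ) F 0 χ)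
    (hH : ∀ Λ, StronglyMeasurable fun ω => (Φ ω).hamiltonian Λ) (k : ℕ) :
    ∀ᵐ ω ∂P, ∑' n : ℕ, boxTransport (Φ ω) χ k (n + (k + R) + 1)
      (box (n + (k + R) + 1) \ box (n + k)) ≠ ∞ := by
  have hm : ∀ n : ℕ, Measurable fun ω => boxTransport (Φ ω) χ k (n + (k + R) + 1)
      (box (n + (k + R) + 1) \ box (n + k)) := fun n => measurable_boxTransport hH _ _ _
  have hfin : ∫⁻ ω, ∑' n : ℕ, boxTransport (Φ ω) χ k (n + (k + R) + 1)
      (box (n + (k + R) + 1) \ box (n + k)) ∂P ≠ ∞ := by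
    rw [lintegral_tsum fun n => (hm n).aemeasurable]
    refine ne_top_of_le_ne_top (((summable_nat_add_iff 1).2 hF).tsum_ofReal_ne_top)
      (ENNReal.tsum_le_tsum fun n => ?_)
    refine lintegral_boxTransport_le hFd hb Finset.sdiff_subset
      ⟨((n + (k + R) + 1 : ℕ) : ℤ), ?_⟩ fun y hy => ?_
    · simp only [box, Finset.mem_sdiff, Finset.mem_Icc]
      omega
    · simp only [box, Finset.mem_sdiff, Finset.mem_Icc] at hy
      omega
  filter_upwards [ae_lt_top (Measurable.tsum hm) hfin] with ω hω using hω.ne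

theorem tendsto_ofReal_sub {F : ℕ → ℝ} (hFd : IsDecayFunction F) (c : ℕ) :
    Tendsto (fun n => ENNReal.ofReal (F (n - c))) atTop (𝓝 0) := by
  rw [← ENNReal.ofReal_zero]
  exact (ENNReal.continuous_ofReal.tendsto 0).comp
    (hFd.tendsto_zero.comp (tendsto_sub_atTop_nat c))

theorem ae_confined (hFd : IsDecayFunction F)
    (hb : LocalizationBound P (fun Λ ω => (Φ ω).hamiltonian Λ) F 0 χ)
    (hH : ∀ Λ, StronglyMeasurable fun ω => (Φ ω).hamiltonian Λ) (k : ℕ) :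
    ∀ᵐ ω ∂P, ∀ ε : ℝ≥0∞, ε ≠ 0 →
      ∃ m, liminf (fun n => boxTransport (Φ ω) χ k n (box n \ box m)) atTop < ε := by
  have h := ae_exists_lt_of_lintegral_le (P := P)
    (f := fun m ω => liminf (fun n => boxTransport (Φ ω) χ k n (box n \ box m)) atTop)
    (fun m => Measurable.liminf fun n => measurable_boxTransport hH _ _ _)
    (tendsto_ofReal_sub hFd k) k fun m hm => by
      refine lintegral_liminf_le_of_eventually_le (fun n => measurable_boxTransport hH _ _ _)
        tendsto_const_nhds ?_
      filter_upwards [eventually_gt_atTop m] with n hn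
      refine lintegral_boxTransport_le hFd hb Finset.sdiff_subset ⟨(n : ℤ), ?_⟩ fun y hy => ?_
      · simp only [box, Finset.mem_sdiff, Finset.mem_Icc]
        omega
      · simp only [box, Finset.mem_sdiff, Finset.mem_Icc] at hy
        omega
  filter_upwards [h] with ω hω ε hε
  obtain ⟨m, -, hm⟩ := hω ε hε
  exact ⟨m, hm⟩

/-- An energy term starting at `x` reaches up to `R` sites towards the box, so its distance from
`box k` is at least `|x| - (k + R)`. The sum over `x` is dominated by a tail of a convergent series
over `ℤ`. -/
theorem lintegral_tailTransport_le (hFd : IsDecayFunction F)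
    (hb : LocalizationBound P (fun Λ ω => (Φ ω).hamiltonian Λ) F 0 χ)
    (hH : ∀ Λ, StronglyMeasurable fun ω => (Φ ω).hamiltonian Λ) {k m n : ℕ} (hm : k + R ≤ m)
    (hn : m + R < n) : ∫⁻ ω, tailTransport (Φ ω) χ R k m n ∂P ≤
      ENNReal.ofReal (F (n - (k + R))) +
        ∑' x : {x // x ∉ box m}, ENNReal.ofReal (F (x.1.natAbs - (k + R))) := by
  unfold tailTransport
  rw [lintegral_add_left (measurable_boxTransport hH _ _ _),
    lintegral_finsetSum _ fun _ _ => measurable_boxTransport hH _ _ _]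
  refine add_le_add ?_ ?_
  · refine lintegral_boxTransport_le hFd hb (fun y hy => ?_) ⟨(n : ℤ), ?_⟩ fun y hy => ?_
    · simp only [box, Finset.mem_Icc] at hy ⊢
      omega
    · rw [Finset.mem_Icc]
      omega
    · rw [Finset.mem_Icc] at hy
      omega
  · refine le_trans (Finset.sum_le_sum (g := ({x | x ∉ box m} : Set ℤ).indicator
      fun x : ℤ => ENNReal.ofReal (F (x.natAbs - (k + R)))) fun x hx => ?_)
      ((ENNReal.sum_le_tsum _).trans_eq (tsum_subtype _ _).symm)
    have hx' : x ∈ ({x | x ∉ box m} : Set ℤ) := (Finset.mem_sdiff.1 hx).2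
    rw [Set.indicator_of_mem hx']
    simp only [box, Finset.mem_sdiff, Finset.mem_Icc] at hx
    refine lintegral_boxTransport_le hFd hb (fun y hy => ?_) ⟨x, ?_⟩ fun y hy => ?_
    · simp only [box, Finset.mem_Icc] at hy ⊢
      omega
    · rw [Finset.mem_Icc]
      omega
    · rw [Finset.mem_Icc] at hy
      omega

theorem ae_tail (hFd : IsDecayFunction F) (hF : Summable F)
    (hb : LocalizationBound P (fun Λ ω => (Φ ω).hamiltonian Λ) F 0 χ)
    (hH : ∀ Λ, StronglyMeasurable fun ω => (Φ ω).hamiltonian Λ) (k : ℕ) :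
    ∀ᵐ ω ∂P, ∀ ε : ℝ≥0∞, ε ≠ 0 →
      ∃ m, k + R ≤ m ∧ liminf (fun n => tailTransport (Φ ω) χ R k m n) atTop < ε := by
  refine ae_exists_lt_of_lintegral_le (P := P)
    (f := fun m ω => liminf (fun n => tailTransport (Φ ω) χ R k m n) atTop)
    (g := fun m => ∑' x : {x // x ∉ box m}, ENNReal.ofReal (F (x.1.natAbs - (k + R))))
    (fun m => Measurable.liminf fun n => measurable_tailTransport hH _ _ _)
    ((ENNReal.tendsto_tsum_compl_atTop_zero
      (IsDecayFunction.tsum_int_ne_top hF (k + R))).comp tendsto_box_atTop) (k + R) fun m hm => ?_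
  refine lintegral_liminf_le_of_eventually_le (fun n => measurable_tailTransport hH _ _ _)
    (g := fun n => ENNReal.ofReal (F (n - (k + R))) +
        ∑' x : {x // x ∉ box m}, ENNReal.ofReal (F (x.1.natAbs - (k + R)))) ?_ ?_
  · simpa using (tendsto_ofReal_sub hFd (k + R)).add_const
      (∑' x : {x // x ∉ box m}, ENNReal.ofReal (F (x.1.natAbs - (k + R))))
  · filter_upwards [eventually_gt_atTop (m + R)] with n hn
    exact lintegral_tailTransport_le hFd hb hH hm hn

/-- Almost every realization of a dynamically localized interaction is localized. -/
theorem ae_localized (hχ : ∀ n, 0 < χ n) (hFd : IsDecayFunction F) (hF : Summable F)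
    (hb : LocalizationBound P (fun Λ ω => (Φ ω).hamiltonian Λ) F 0 χ)
    (hH : ∀ Λ, StronglyMeasurable fun ω => (Φ ω).hamiltonian Λ)
    (hR : ∀ᵐ ω ∂P, (Φ ω).HasRange R) (hJ : ∀ᵐ ω ∂P, ∀ X, ‖(Φ ω).toFun X‖ ≤ J) :
    ∀ᵐ ω ∂P, Localized (Φ ω) χ R J := by
  filter_upwards [hR, hJ, ae_all_iff.2 (ae_summable_boxTransport (R := R) hFd hF hb hH),
    ae_all_iff.2 (ae_confined hFd hb hH), ae_all_iff.2 (ae_tail (R := R) hFd hF hb hH)]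
    with ω h1 h2 h3 h4 h5
  exact ⟨hχ, h1, h2, h3, h4, h5⟩

open Classical in
theorem lintegral_leakage_le_of_disjoint [IsProbabilityMeasure P] (hFd : IsDecayFunction F)
    (hb : LocalizationBound P (fun Λ ω => (Φ ω).hamiltonian Λ) F 0 χ)
    (hH : ∀ Λ, StronglyMeasurable fun ω => (Φ ω).hamiltonian Λ)
    {τ : Ω → ℝ → quasiLocal d ≃⋆ₐ[ℂ] quasiLocal d} {x : ℤ} {I : Ω → quasiLocal d}
    (h : ∀ᵐ ω ∂P, Localized (Φ ω) χ R J) (hτ : ∀ᵐ ω ∂P, IsThermodynamicLimit (Φ ω) (τ ω))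
    (hI : ∀ᵐ ω ∂P, IsTimeAverage (τ ω) ((Φ ω).energy R x) (I ω)) {Y : Set ℤ} (hY : Y.Nonempty)
    (hdis : ∀ y ∈ Y, y < x ∨ x + R < y) :
    ∫⁻ ω, leakage (I ω : Op d) Y ∂P ≤
      ENNReal.ofReal (2 * χ (R + 1) * (2 ^ (R + 1) * J)) *
        ENNReal.ofReal (F (siteDist (Set.Icc x (x + R)) Y)) := by
  have hcard : (Finset.Icc x (x + R)).card = R + 1 := by rw [Int.card_Icc]; omega
  set c := ENNReal.ofReal (2 * χ (R + 1) * (2 ^ (R + 1) * J)) with hc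
  have hm : ∀ n : ℕ, Measurable fun ω => transport ((Φ ω).hamiltonian (box n))
      (χ (Finset.Icc x (x + R)).card) 0 (Finset.Icc x (x + R)) {y ∈ box n | y ∈ Y} :=
    fun n => measurable_transport (hH _) _ _ _
  refine (lintegral_mono_ae (g := fun ω => liminf (fun n : ℕ => c *
    transport ((Φ ω).hamiltonian (box n)) (χ (Finset.Icc x (x + R)).card) 0
      (Finset.Icc x (x + R)) {y ∈ box n | y ∈ Y}) atTop) ?_).trans ?_
  · filter_upwards [h, hτ, hI] with ω h1 h2 h3
    have := h2.leakage_average_le h1 h3 Y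
    rw [hcard] at this ⊢
    exact this
  · refine lintegral_liminf_le_of_eventually_le (fun n => (hm n).const_mul c)
      tendsto_const_nhds ?_
    obtain ⟨y₀, hy₀⟩ := hY
    -- Large enough for the box to contain `[x, x + R]` and one site of `Y`: the localization bound
    -- requires nonempty sets inside the volume.
    filter_upwards [eventually_ge_atTop (x.natAbs + R + y₀.natAbs)] with n hn
    rw [lintegral_const_mul _ (hm n)]
    refine mul_le_mul' le_rfl (lintegral_transport_le hFd hb (by omega) (fun z hz => ?_)
      (Finset.filter_subset _ _) ⟨y₀, ?_⟩ (fun y hy => hdis y (Finset.mem_filter.1 hy).2)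
      fun z hz y hy => ?_)
    · simp only [box, Finset.mem_Icc] at hz ⊢
      omega
    · rw [Finset.mem_filter, box, Finset.mem_Icc]
      exact ⟨by omega, hy₀⟩
    · exact siteDist_le (Finset.mem_Icc.1 hz) (Finset.mem_filter.1 hy).2

theorem leakage_le (T : Op d) (Y : Set ℤ) : leakage T Y ≤ ENNReal.ofReal (2 * ‖T‖) := by
  refine iSup₂_le fun B hB => ENNReal.ofReal_le_ofReal ?_
  refine (norm_comm_le T B).trans ?_
  exact mul_le_of_le_one_right (by positivity) hB.2

/-- If `Y` misses `[x, x + R]`, localization applies. Otherwise the distance is zero and the trivial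
commutator bound is absorbed by dividing by `F 0`. -/
theorem exists_lintegral_leakage_le [IsProbabilityMeasure P] (hχ : ∀ n, 0 < χ n)
    (hFd : IsDecayFunction F)
    (hb : LocalizationBound P (fun Λ ω => (Φ ω).hamiltonian Λ) F 0 χ)
    (hH : ∀ Λ, StronglyMeasurable fun ω => (Φ ω).hamiltonian Λ)
    {τ : Ω → ℝ → quasiLocal d ≃⋆ₐ[ℂ] quasiLocal d} {I : ℤ → Ω → quasiLocal d}
    (h : ∀ᵐ ω ∂P, Localized (Φ ω) χ R J) (hτ : ∀ᵐ ω ∂P, IsThermodynamicLimit (Φ ω) (τ ω))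
    (hI : ∀ᵐ ω ∂P, ∀ x, IsTimeAverage (τ ω) ((Φ ω).energy R x) (I x ω)) :
    ∃ C : ℝ, 0 < C ∧ ∀ (x : ℤ) (Y : Set ℤ), Y.Nonempty →
      ∫⁻ ω, leakage (I x ω : Op d) Y ∂P ≤
        ENNReal.ofReal (C * F (siteDist (Set.Icc x (x + R)) Y)) := by
  have hJ : 0 ≤ J := by
    obtain ⟨ω, hω⟩ := h.exists
    exact hω.nonneg
  have hF0 := hFd.pos 0
  have hχR := hχ (R + 1)
  set C₁ := 2 * χ (R + 1) * (2 ^ (R + 1) * J) with hC₁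
  set C₂ := 2 * (2 ^ (R + 1) * J) / F 0 with hC₂
  have h1 : 0 ≤ C₁ := by positivity
  have h2 : 0 ≤ C₂ := by positivity
  refine ⟨C₁ + C₂ + 1, by positivity, fun x Y hY => ?_⟩
  by_cases hdis : ∀ y ∈ Y, y < x ∨ x + R < y
  · refine (lintegral_leakage_le_of_disjoint hFd hb hH h hτ
      (hI.mono fun ω hω => hω x) hY hdis).trans ?_
    rw [← ENNReal.ofReal_mul h1]
    refine ENNReal.ofReal_le_ofReal (mul_le_mul_of_nonneg_right ?_ (hFd.pos _).le)
    linarith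
  · push Not at hdis
    obtain ⟨y, hy, hxy, hyx⟩ := hdis
    have h0 : siteDist (Set.Icc x (x + R)) Y = 0 := by
      have := siteDist_le (X := Set.Icc x (x + R)) (Y := Y) ⟨hxy, hyx⟩ hy
      simpa using this
    rw [h0]
    have hle : ∀ᵐ ω ∂P, leakage (I x ω : Op d) Y ≤ ENNReal.ofReal (2 * (2 ^ (R + 1) * J)) := by
      filter_upwards [h, hτ, hI] with ω h1 h2 h3
      refine (leakage_le _ _).trans (ENNReal.ofReal_le_ofReal ?_)
      have := (h2.norm_average_le (h3 x)).trans (Interaction.norm_energy_le h1.bound R x)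
      gcongr
    refine (lintegral_mono_ae hle).trans ?_
    rw [lintegral_const, measure_univ, mul_one]
    refine ENNReal.ofReal_le_ofReal ?_
    have : C₂ * F 0 = 2 * (2 ^ (R + 1) * J) := by rw [hC₂]; field_simp
    nlinarith [mul_nonneg h1 hF0.le]

/-- No measurability of `τ` in `ω` is given, so the average is reached as an iterated limit of
integrals of finite-volume dynamics, with dominated convergence in the time integral. -/
theorem aestronglyMeasurable_average
    (hH : ∀ Λ, StronglyMeasurable fun ω => (Φ ω).hamiltonian Λ)
    {τ : Ω → ℝ → quasiLocal d ≃⋆ₐ[ℂ] quasiLocal d} {A I : Ω → quasiLocal d}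
    (hA : StronglyMeasurable fun ω => (A ω : Op d))
    (hτ : ∀ᵐ ω ∂P, IsThermodynamicLimit (Φ ω) (τ ω))
    (hI : ∀ᵐ ω ∂P, IsTimeAverage (τ ω) (A ω) (I ω)) : AEStronglyMeasurable I P := by
  rw [← (isometry_subtype_coe
    (s := (quasiLocal d : Set (Op d)))).isEmbedding.aestronglyMeasurable_comp_iff]
  refine aestronglyMeasurable_of_tendsto_ae atTop
    (f := fun (n : ℕ) ω => (n : ℝ)⁻¹ • ∫ t in (0 : ℝ)..n, (τ ω t (A ω) : Op d))
    (fun n : ℕ => ?_) hI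
  refine AEStronglyMeasurable.const_smul ?_ ((n : ℝ)⁻¹)
  refine aestronglyMeasurable_of_tendsto_ae atTop (f := fun (m : ℕ) ω =>
    ∫ t in (0 : ℝ)..n, heisenberg ((Φ ω).hamiltonian (box m)) t (A ω)) (fun m : ℕ =>
    (stronglyMeasurable_integral_heisenberg (hH (box m)) hA n).aestronglyMeasurable) ?_
  filter_upwards [hτ] with ω hω
  refine intervalIntegral.tendsto_integral_filter_of_dominated_convergence (fun _ => ‖A ω‖)
    (Eventually.of_forall fun m => ?_) (Eventually.of_forall fun m => ?_)
    intervalIntegrable_const ?_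
  · exact (continuous_heisenberg_comp continuous_const continuous_id
      continuous_const).aestronglyMeasurable
  · exact Eventually.of_forall fun t _ =>
      (norm_heisenberg ((Φ ω).isSelfAdjoint_hamiltonian _) t _).le
  · exact Eventually.of_forall fun t _ => hω.tendsto t (A ω)

end Random

theorem IsDecayFunction.factor_pos {F : ℕ → ℝ} (hFd : IsDecayFunction F) {K : ℝ}
    (hK : ∀ n, F n ≤ K * F (n + 1)) : 0 < K :=
  pos_of_mul_pos_left ((hFd.pos 0).trans_le (hK 0)) (hFd.pos (0 + 1)).le

theorem IsDecayFunction.le_pow_mul {F : ℕ → ℝ} (hFd : IsDecayFunction F) {K : ℝ}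
    (hK : ∀ n, F n ≤ K * F (n + 1)) (n j : ℕ) : F n ≤ K ^ j * F (n + j) := by
  have hK0 := hFd.factor_pos hK
  induction j with
  | zero => simp
  | succ j ih =>
    refine ih.trans ?_
    rw [pow_succ, mul_assoc, ← add_assoc]
    exact mul_le_mul_of_nonneg_left (hK _) (by positivity)

theorem stronglyMeasurable_energy {Φ : Ω → Interaction d}
    (h : ∀ X, StronglyMeasurable fun ω => (Φ ω).toFun X) (R : ℕ) (x : ℤ) :
    StronglyMeasurable fun ω => ((Φ ω).energy R x : Op d) := by
  simp only [Interaction.coe_energy]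
  exact Finset.stronglyMeasurable_fun_sum _ fun X _ => h X

end SpinChain

end

/-! ### Assembly of the theorem -/

open SpinChain
theorem theorem2p6 {d : ℤ → ℕ} (hd : ∀ x, 1 ≤ d x)
    {Ω : Type*} [MeasurableSpace Ω] (P : Measure Ω) [IsProbabilityMeasure P]
    (Φ : Ω → Interaction d)
    (hΦ_meas : ∀ (X : Finset ℤ) (φ ψ : Hil d), Measurable fun ω => ⟪φ, (Φ ω).toFun X ψ⟫_ℂ)
    (R : ℕ) (hΦ_range : ∀ᵐ ω ∂P, (Φ ω).HasRange R)
    (J : ℝ) (hΦ_bdd : ∀ᵐ ω ∂P, ∀ X, ‖(Φ ω).toFun X‖ ≤ J)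
    (F : ℕ → ℝ)
    (hloc : DynamicallyLocalizedUniformly P (fun Λ ω => (Φ ω).hamiltonian Λ) F)
    (hF : Summable fun n : ℕ => (n : ℝ) * F n) :
    ∃ τ : Ω → ℝ → quasiLocal d ≃⋆ₐ[ℂ] quasiLocal d,
      (∀ᵐ ω ∂P, IsThermodynamicLimit (Φ ω) (τ ω)) ∧
      ∃ (T : Ω → ℕ → ℕ) (I : ℤ → Ω → quasiLocal d),
        (∀ n, Measurable fun ω => T ω n) ∧ (∀ ω, StrictMono (T ω)) ∧
        (∀ᵐ ω ∂P, ∀ x, Tendsto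
          (fun n : ℕ => (T ω n : ℝ)⁻¹ •
            ∫ t in (0 : ℝ)..(T ω n : ℝ), (τ ω t ((Φ ω).energy R x) : Op d))
          atTop (𝓝 (I x ω : Op d))) ∧
        IsLIOMFamily P τ I ∧
        (∀ᵐ ω ∂P, ∀ t x, τ ω t (I x ω) = I x ω) ∧
        (∃ C : ℝ, 0 < C ∧ ∀ (x : ℤ) (Y : Set ℤ), Y.Nonempty →
          ∫⁻ ω, leakage (I x ω : Op d) Y ∂P ≤
            ENNReal.ofReal (C * F (siteDist (Set.Icc x (x + R)) Y))) ∧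
        ((∃ K : ℝ, ∀ n, F n ≤ K * F (n + 1)) →
          ∃ C : ℝ, 0 < C ∧ ∀ (x : ℤ) (Y : Set ℤ), Y.Nonempty →
            ∫⁻ ω, leakage (I x ω : Op d) Y ∂P ≤ ENNReal.ofReal (C * F (siteDist {x} Y))) := by
  obtain ⟨hFd, χ, hχ, hb⟩ := hloc
  have hΦ : ∀ X, StronglyMeasurable fun ω => (Φ ω).toFun X := fun X =>
    stronglyMeasurable_of_weak hd (fun ω => (Φ ω).mem_localAlgebra X) (hΦ_meas X)
  have hH : ∀ Λ, StronglyMeasurable fun ω => (Φ ω).hamiltonian Λ := fun Λ =>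
    Finset.stronglyMeasurable_fun_sum _ fun X _ => hΦ X
  have hL : ∀ᵐ ω ∂P, Localized (Φ ω) χ R J :=
    ae_localized hχ hFd (hFd.summable hF) hb hH hΦ_range hΦ_bdd
  have hexτ : ∀ ω, ∃ τ : ℝ → quasiLocal d ≃⋆ₐ[ℂ] quasiLocal d,
      Localized (Φ ω) χ R J → IsThermodynamicLimit (Φ ω) τ := by
    intro ω
    by_cases h : Localized (Φ ω) χ R J
    · obtain ⟨τ, hτ⟩ := h.exists_isThermodynamicLimit
      exact ⟨τ, fun _ => hτ⟩
    -- Off the event of localized realizations, which has full measure, the dynamics is set to the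
    -- identity.
    · exact ⟨fun _ => StarAlgEquiv.refl ℂ _, fun h' => absurd h' h⟩
  choose τ hτ using hexτ
  have hexI : ∀ x ω, ∃ I : quasiLocal d,
      Localized (Φ ω) χ R J → IsTimeAverage (τ ω) ((Φ ω).energy R x) I := by
    intro x ω
    by_cases h : Localized (Φ ω) χ R J
    · obtain ⟨I, hI, -⟩ := (hτ ω h).exists_isTimeAverage h ⟨_, (Φ ω).energy_mem R x⟩
      exact ⟨I, fun _ => hI⟩
    · exact ⟨0, fun h' => absurd h' h⟩
  choose I₀ hI₀ using hexI
  have hτ' : ∀ᵐ ω ∂P, IsThermodynamicLimit (Φ ω) (τ ω) := hL.mono hτ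
  have hmeas : ∀ x, AEStronglyMeasurable (I₀ x) P := fun x =>
    aestronglyMeasurable_average hH (stronglyMeasurable_energy hΦ R x) hτ' (hL.mono (hI₀ x))
  -- The chosen averages are replaced by strongly measurable versions; `ℤ` is countable, so they
  -- agree for all `x` off one null set.
  have hI : ∀ᵐ ω ∂P, ∀ x,
      IsTimeAverage (τ ω) ((Φ ω).energy R x) ((hmeas x).mk (I₀ x) ω : quasiLocal d) := by
    filter_upwards [hL, ae_all_iff.2 fun x => (hmeas x).ae_eq_mk] with ω h1 h2 x
    rw [← h2 x]
    exact hI₀ x ω h1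
  obtain ⟨C, hC, hleak⟩ := exists_lintegral_leakage_le hχ hFd hb hH hL hτ' hI
  have hinv : ∀ᵐ ω ∂P, ∀ t x, τ ω t ((hmeas x).mk (I₀ x) ω) = (hmeas x).mk (I₀ x) ω := by
    filter_upwards [hL, hτ', hI] with ω h1 h2 h3 t x
    exact h2.map_isTimeAverage h1 ⟨_, (Φ ω).energy_mem R x⟩ (h3 x) t
  refine ⟨τ, hτ', fun _ n => n, fun x => (hmeas x).mk (I₀ x), fun n => measurable_const,
    fun _ => strictMono_id, hI, ?_, hinv, ⟨C, hC, hleak⟩, ?_⟩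
  -- The decay function is shifted by `R`, since `x` may be up to `R` sites further from `Y` than
  -- the interval `[x, x + R]`.
  · refine ⟨fun x => (hmeas x).stronglyMeasurable_mk, ?_, ⟨2 ^ (R + 1) * J, ?_⟩,
      ⟨fun n => C * F (n - R), ⟨fun n => mul_pos hC (hFd.pos _), fun m n hmn =>
        mul_le_mul_of_nonneg_left (hFd.antitone (Nat.sub_le_sub_right hmn R)) hC.le, ?_⟩,
        fun x Y hY => ?_⟩, ?_, ?_, ?_⟩
    · filter_upwards [hτ', hI] with ω h2 h3 x
      exact Subtype.ext (h2.isSelfAdjoint_average (h3 x)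
        (Subtype.ext ((Φ ω).isSelfAdjoint_energy R x)))
    · filter_upwards [hL, hτ', hI] with ω h1 h2 h3 x
      exact (h2.norm_average_le (h3 x)).trans (Interaction.norm_energy_le h1.bound R x)
    · simpa using (hFd.tendsto_zero.comp (tendsto_sub_atTop_nat R)).const_mul C
    · refine (hleak x Y hY).trans (ENNReal.ofReal_le_ofReal
        (mul_le_mul_of_nonneg_left (hFd.antitone ?_) hC.le))
      exact Nat.sub_le_iff_le_add.2 (siteDist_singleton_le hY)
    · filter_upwards [hinv] with ω h x
      simp only [GeneratorAt, h, smul_zero]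
      exact hasDerivAt_const _ _
    · filter_upwards [hL, hτ', hI] with ω h1 h2 h3 A hA
      obtain ⟨B, hB, hgen⟩ := h2.generator A hA
      exact ⟨B, hgen, h2.tendsto_sum_comm_average h1 h3 hA hB⟩
    · filter_upwards [hL, hτ', hI] with ω h1 h2 h3 t A
      exact h2.tendsto_heisenberg_average h1 h3 t A
  · rintro ⟨K, hK⟩
    have hK0 := hFd.factor_pos hK
    -- The same shift by `R` costs one factor `K` per site.
    refine ⟨C * K ^ R, by positivity, fun x Y hY => (hleak x Y hY).trans
      (ENNReal.ofReal_le_ofReal ?_)⟩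
    rw [mul_assoc]
    refine mul_le_mul_of_nonneg_left ((hFd.le_pow_mul hK _ R).trans ?_) hC.le
    exact mul_le_mul_of_nonneg_left (hFd.antitone (siteDist_singleton_le hY)) (by positivity)
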